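/- Let $X$ be a real Banach lattice and let $\mathcal S$ be a semigroup of positive operators on $X$ that is norm closed, closed under multiplication by positive scalars, and ideal irreducible (no closed order ideal other than $\{0\}$ and $X$ is invariant under all $S\in\mathcal S$). Suppose that $r$, the minimal rank of the non-zero operators in $\mathcal S$, is finite. Let $\mathcal P_r$ be the set of projections of rank $r$ in $\mathcal S$, and assume that all $P\in\mathcal P_r$ have the same range $Y$. Then $Y$ is invariant under $\mathcal S$. Write $S_Y$ for the restriction of $S\in\mathcal S$ to $Y$ and $r(S_Y)$ for its spectral radius; then $r(S_Y)>0$ for every non-zero $S\in\mathcal S$. The space $Y$ has a basis $x_1,\dots,x_r$ of pairwise disjoint positive vectors on which every $S\in\mathcal S$ acts as a scalar multiple of a permutation. For every such basis, put $x_0=x_1+\dots+x_r$. Then: (1) $x_0$ is a common eigenvector of $\mathcal S$, namely $Sx_0=r(S_Y)x_0$ for all $S\in\mathcal S$; moreover $x_0>0$ and $x_0$ is quasi-interior (the order ideal generated by $x_0$ is dense in $X$). (2) Up to scaling, $x_0$ is the unique common eigenvector of $\mathcal S$ in the following sense. Let $0\ne y\in X$ and $Sy=\lambda_S y$ with $\lambda_S\in\mathbb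 R$ for all $S\in\mathcal S$. If $y\ge 0$, or if $\lambda_S>0$ for all non-zero $S\in\mathcal S$, then $y$ is a scalar multiple of $x_0$. In general, either $Py=0$ for all $P\in\mathcal P_r$, or $|\lambda_S|=r(S_Y)$ for all $S\in\mathcal S$ and $y=\sum_i a_ix_i$ with $|a_1|=\dots=|a_r|$. (3) Suppose that, in addition, $\mathcal S$ has a unique projection $P$ of rank $r$. Then $P=\sum_{i=1}^r x_i^*\otimes x_i$ for positive functionals $x_1^*,\dots,x_r^*\in X^*$ with $x_i^*(x_j)=\delta_{ij}$, and for every non-zero $S\in\mathcal S$ the operator $\frac1{r(S_Y)}S^*$ permutes $x_1^*,\dots,x_r^*$. The functional $x_0^*=x_1^*+\dots+x_r^*$ is strictly positive ($x_0^*(z)>0$ whenever $z>0$), and $S^*x_0^*=r(S_Y)x_0^*$ for all $S\in\mathcal S$. Up to scaling, $x_0^*$ is the unique common eigenfunctional in the same sense: let $0\ne g\in X^*$ and $S^*g=\lambda_S g$ with $\lambda_S\in\mathbb R$ for all $S\in\mathcal S$. If $g\ge 0$, or if $\lambda_S>0$ for all non-zero $S\in\mathcal S$, then $g$ is a scalar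 multiple of $x_0^*$. In general, either $P^*g=0$, or $|\lambda_S|=r(S_Y)$ for all $S\in\mathcal S$ and $g=\sum_i a_ix_i^*$ with $|a_1|=\dots=|a_r|$. -/

import Mathlib

/-! Semigroups of positive operators on a real Banach lattice. -/

namespace PosSemigroup

section Basic

variable {X : Type*} [NormedAddCommGroup X] [NormedSpace ℝ X] [Lattice X]

/-- A bounded operator is positive if it maps nonnegative vectors to nonnegative vectors. -/
def IsPositiveOp (S : X →L[ℝ] X) : Prop := ∀ x : X, 0 ≤ x → 0 ≤ S x

/-- The semigroup is norm closed and closed under multiplication by positive scalars. -/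
def IsRPlusClosed (𝒮 : Subsemigroup (X →L[ℝ] X)) : Prop :=
  IsClosed (𝒮 : Set (X →L[ℝ] X)) ∧ ∀ S ∈ 𝒮, ∀ c : ℝ, 0 < c → c • S ∈ 𝒮

/-- An (order) ideal: a solid linear subspace. -/
def IsOrderIdeal (J : Submodule ℝ X) : Prop :=
  LatticeOrderedAddCommGroup.IsSolid (J : Set X)

/-- There is no closed order ideal, other than `0` and `X`, which is invariant under every
operator of the semigroup. -/
def IsIdealIrreducible (𝒮 : Subsemigroup (X →L[ℝ] X)) : Prop :=
  ∀ J : Submodule ℝ X, IsOrderIdeal J → IsClosed (J : Set X) →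
    (∀ S ∈ 𝒮, ∀ x ∈ J, S x ∈ J) → J = ⊥ ∨ J = ⊤

/-- The rank of an operator, `⊤` if the range is infinite-dimensional. -/
noncomputable def opRank (S : X →L[ℝ] X) : ℕ∞ :=
  Cardinal.toENat (LinearMap.rank (S : X →ₗ[ℝ] X))

/-- The minimal rank of the nonzero operators in the semigroup; it is `⊤` if the semigroup has no
nonzero operator of finite rank. -/
noncomputable def minRank (𝒮 : Subsemigroup (X →L[ℝ] X)) : ℕ∞ :=
  ⨅ S ∈ {S : X →L[ℝ] X | S ∈ 𝒮 ∧ S ≠ 0}, opRank S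

/-- The set of all projections of rank `r` in the semigroup. -/
def rankProjections (𝒮 : Subsemigroup (X →L[ℝ] X)) (r : ℕ) : Set (X →L[ℝ] X) :=
  {P | P ∈ 𝒮 ∧ P * P = P ∧ opRank P = r}

/-- A quasi-interior vector: a nonnegative vector which generates a dense order ideal. -/
def IsQuasiInterior (u : X) : Prop :=
  0 ≤ u ∧ Dense {x : X | ∃ c : ℝ, |x| ≤ c • u}

/-- The vectors `x i` are positive, pairwise disjoint and form a basis of `Y`, and each operator
in the semigroup acts on them as a scalar multiple of a permutation. -/
structure IsPermutedBasis (𝒮 : Subsemigroup (X →L[ℝ] X)) (Y : Submodule ℝ X) {r : ℕ}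
    (x : Fin r → X) : Prop where
  pos : ∀ i, 0 < x i
  disjoint : ∀ i j, i ≠ j → x i ⊓ x j = 0
  linearIndependent : LinearIndependent ℝ x
  span_eq : Submodule.span ℝ (Set.range x) = Y
  permutes : ∀ S ∈ 𝒮, ∃ (c : ℝ) (σ : Equiv.Perm (Fin r)), ∀ i, S (x i) = c • x (σ i)

end Basic

/-- The spectral radius of a linear operator on a real vector space, that is, the spectral radius
of its complexification. (It is used for finite-dimensional spaces only.) -/
noncomputable def realSpectralRadius {V : Type*} [AddCommGroup V] [Module ℝ V]
    (T : Module.End ℝ V) : ℝ :=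
  (spectralRadius ℂ (LinearMap.baseChange ℂ T : Module.End ℂ (TensorProduct ℝ ℂ V))).toReal

/-- The spectral radius `r(S_Y)` of the restriction `S_Y` of `S` to an invariant subspace `Y`. -/
noncomputable def restrictRadius {X : Type*} [NormedAddCommGroup X] [NormedSpace ℝ X]
    (S : X →L[ℝ] X) (Y : Submodule ℝ X) (h : ∀ y ∈ Y, S y ∈ Y) : ℝ :=
  realSpectralRadius ((S : X →ₗ[ℝ] X).restrict h)

/-- The Banach space adjoint `S* : X* → X*`, `S* f = f ∘ S`. -/
noncomputable def bdual {X : Type*} [NormedAddCommGroup X] [NormedSpace ℝ X]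
    (S : X →L[ℝ] X) : StrongDual ℝ X →L[ℝ] StrongDual ℝ X :=
  ContinuousLinearMap.precomp ℝ S

/-- `y` is a common eigenvector of the operators `T i`, with eigenvalues `lam i`. -/
def IsCommonEigenvector {ι E : Type*} [NormedAddCommGroup E] [NormedSpace ℝ E]
    (T : ι → E →L[ℝ] E) (lam : ι → ℝ) (y : E) : Prop :=
  y ≠ 0 ∧ ∀ i, T i y = lam i • y

end PosSemigroup

set_option linter.unusedSectionVars false

namespace PosSemigroup

/-! ### Positive operators, absolute kernels and disjointness -/

section Lattice

variable {X : Type*} [NormedAddCommGroup X] [NormedSpace ℝ X] [Lattice X] [IsOrderedAddMonoid X]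
  [IsOrderedModule ℝ X]

/-! Irreducibility enters mainly in one form: for nonzero positive `L` and `z > 0`, some `R` in the
semigroup has `L (R z) ≠ 0` (`exists_apply_ne_zero`). Closedness enters mainly through compactness:
normalised powers of an operator that is invertible on a finite-dimensional space accumulate at an
invertible element, and ratios of these powers approximate the identity. So an operator of minimal
rank that is injective on its range yields, inside the semigroup, a projection onto that range and
an inverse there (`exists_projection_and_inverse`).

When all minimal projections share the range `Y`, every nonzero operator of minimal rank has range
`Y`. Hence `Y` is invariant, and each nonzero `S` is invertible on `Y` with inverse induced by the
semigroup. Comparing different projections shows that `Y` is closed under the modulus (`abs_mem`),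
so this finite-dimensional sublattice has a disjoint positive basis. A positive operator with
positive inverse permutes such a basis up to positive weights.

The weights are removed by rescaling. A diagonal operator of the semigroup is scalar on `Y`, since
otherwise its normalised powers would converge to a nonzero operator that is not injective on `Y`.
Thus an operator whose weights have product 1 has weight 1 at every fixed point of its permutation.
By transitivity, pushing one basis vector around with operators of weight product 1 gives a basis
permuted without weights (`exists_isPermutedBasis`).

On this basis some power of `S` is scalar, so `r(S_Y)` is the common weight and the sum of the basis
is an eigenvector. Uniqueness is a statement about coefficient vectors under a transitive family of
permutations (`eigenCoefficients`). If the minimal projection is unique it commutes with the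
semigroup, so its coordinate functionals are permuted by the adjoints and the same coefficient
argument applies. -/

theorem abs_smul_le_smul_abs (c : ℝ) (x : X) : |c • x| ≤ |c| • |x| := by
  have key : ∀ (d : ℝ) (y : X), d • y ≤ |d| • |y| := by
    intro d y
    rcases le_total 0 d with hd | hd
    · rw [abs_of_nonneg hd]
      exact smul_le_smul_of_nonneg_left (le_abs_self y) hd
    · rw [abs_of_nonpos hd, ← neg_smul_neg]
      exact smul_le_smul_of_nonneg_left (neg_le_abs y) (neg_nonneg.2 hd)
  refine abs_le'.2 ⟨key c x, ?_⟩
  rw [← neg_smul]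
  simpa using key (-c) x

section Positive

variable {E : Type*} [NormedAddCommGroup E] [NormedSpace ℝ E] [PartialOrder E]
  [IsOrderedAddMonoid E]

theorem apply_le_apply_of_nonneg {L : X →L[ℝ] E} (hL : ∀ x, 0 ≤ x → 0 ≤ L x) {x y : X}
    (h : x ≤ y) : L x ≤ L y := by
  have := hL (y - x) (sub_nonneg.2 h)
  rwa [map_sub, sub_nonneg] at this

theorem apply_eq_zero_of_apply_abs {L : X →L[ℝ] E} (hL : ∀ x, 0 ≤ x → 0 ≤ L x) {x : X}
    (h : L |x| = 0) : L x = 0 := by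
  refine le_antisymm ((apply_le_apply_of_nonneg hL (le_abs_self x)).trans h.le) ?_
  have := (apply_le_apply_of_nonneg hL (neg_le_abs x)).trans h.le
  rwa [map_neg, neg_nonpos] at this

theorem apply_eq_zero_of_le {L : X →L[ℝ] E} (hL : ∀ x, 0 ≤ x → 0 ≤ L x) {x y : X}
    (hx : 0 ≤ x) (hxy : x ≤ y) (h : L y = 0) : L x = 0 :=
  le_antisymm ((apply_le_apply_of_nonneg hL hxy).trans h.le) (hL x hx)

/-- The vectors whose modulus is annihilated by a family of positive operators. -/
def absKernel {ι : Type*} (L : ι → X →L[ℝ] E) (hL : ∀ i x, 0 ≤ x → 0 ≤ L i x) :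
    Submodule ℝ X where
  carrier := {y | ∀ i, L i |y| = 0}
  zero_mem' := fun i => by simp
  add_mem' := fun {a b} ha hb i => apply_eq_zero_of_le (hL i) (abs_nonneg _) (abs_add_le a b)
    (by rw [map_add, ha i, hb i, add_zero])
  smul_mem' := fun c a ha i => apply_eq_zero_of_le (hL i) (abs_nonneg _)
    (abs_smul_le_smul_abs c a) (by rw [map_smul, ha i, smul_zero])

theorem mem_absKernel {ι : Type*} {L : ι → X →L[ℝ] E} {hL : ∀ i x, 0 ≤ x → 0 ≤ L i x} {y : X} :
    y ∈ absKernel L hL ↔ ∀ i, L i |y| = 0 := Iff.rfl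

theorem isOrderIdeal_absKernel {ι : Type*} (L : ι → X →L[ℝ] E)
    (hL : ∀ i x, 0 ≤ x → 0 ≤ L i x) : IsOrderIdeal (absKernel L hL) :=
  fun _ hx _ hyx i => apply_eq_zero_of_le (hL i) (abs_nonneg _) hyx (hx i)

end Positive

theorem IsPositiveOp.mono {S : X →L[ℝ] X} (hS : IsPositiveOp S) {x y : X} (h : x ≤ y) :
    S x ≤ S y := apply_le_apply_of_nonneg hS h

theorem IsPositiveOp.abs_apply_le {S : X →L[ℝ] X} (hS : IsPositiveOp S) (x : X) :
    |S x| ≤ S |x| := by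
  refine abs_le'.2 ⟨hS.mono (le_abs_self x), ?_⟩
  rw [← map_neg]
  exact hS.mono (neg_le_abs x)

section Irreducible

variable [HasSolidNorm X] {E : Type*} [NormedAddCommGroup E] [NormedSpace ℝ E] [PartialOrder E]
  [IsOrderedAddMonoid E]

theorem isClosed_absKernel {ι : Type*} (L : ι → X →L[ℝ] E)
    (hL : ∀ i x, 0 ≤ x → 0 ≤ L i x) : IsClosed (absKernel L hL : Set X) := by
  have : (absKernel L hL : Set X) = ⋂ i, {y | L i |y| = 0} := by
    ext y
    simp [mem_absKernel]
  rw [this]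
  refine isClosed_iInter fun i => isClosed_eq ((L i).continuous.comp ?_) continuous_const
  exact (continuous_id.sup continuous_neg)

theorem absKernel_eq_bot_or_top {𝒮 : Subsemigroup (X →L[ℝ] X)}
    (hpos : ∀ S ∈ 𝒮, IsPositiveOp S) (hirr : IsIdealIrreducible 𝒮)
    {ι : Type*} (L : ι → X →L[ℝ] E) (hL : ∀ i x, 0 ≤ x → 0 ≤ L i x)
    (h : ∀ S ∈ 𝒮, ∀ y ∈ absKernel L hL, ∀ i, L i (S |y|) = 0) :
    absKernel L hL = ⊥ ∨ absKernel L hL = ⊤ :=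
  hirr _ (isOrderIdeal_absKernel L hL) (isClosed_absKernel L hL) fun S hS y hy i =>
    apply_eq_zero_of_le (hL i) (abs_nonneg _) ((hpos S hS).abs_apply_le y) (h S hS y hy i)

/-- In an ideal irreducible semigroup, nothing positive is annihilated by all `L ∘ R`. -/
theorem exists_apply_ne_zero {𝒮 : Subsemigroup (X →L[ℝ] X)}
    (hpos : ∀ S ∈ 𝒮, IsPositiveOp S) (hirr : IsIdealIrreducible 𝒮)
    (hne : ∃ S ∈ 𝒮, S ≠ 0) {L : X →L[ℝ] E} (hL : ∀ x, 0 ≤ x → 0 ≤ L x) (hL0 : L ≠ 0)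
    {z : X} (hz : 0 ≤ z) (hz0 : z ≠ 0) : ∃ R ∈ 𝒮, L (R z) ≠ 0 := by
  by_contra! hcon
  have hLR : ∀ (R : 𝒮) x, 0 ≤ x → 0 ≤ (L.comp (R : X →L[ℝ] X)) x :=
    fun R x hx => hL _ (hpos R R.2 x hx)
  have hN : ∀ R ∈ 𝒮, ∀ y, L (R y) = 0 := by
    -- This kernel is invariant because `R * S` again lies in the semigroup. It contains `z`, so it
    -- must be everything.
    rcases absKernel_eq_bot_or_top hpos hirr (fun R : 𝒮 => L.comp (R : X →L[ℝ] X)) hLR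
      (fun S hS y hy R => by exact hy (R * (⟨S, hS⟩ : 𝒮))) with h | h
    · exfalso
      have : z ∈ absKernel (fun R : 𝒮 => L.comp (R : X →L[ℝ] X)) hLR :=
        fun R => by rw [abs_of_nonneg hz]; exact hcon R R.2
      rw [h, Submodule.mem_bot] at this
      exact hz0 this
    · intro R hR y
      have : y ∈ absKernel (fun R : 𝒮 => L.comp (R : X →L[ℝ] X)) hLR := h ▸ Submodule.mem_top
      exact apply_eq_zero_of_apply_abs (hLR ⟨R, hR⟩) (this ⟨R, hR⟩)
  -- The semigroup need not contain the identity, so `L ∘ R = 0` for all `R` does not yet give `L =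
  -- 0`. The kernel of `L` alone is now invariant, since it absorbs every range.
  rcases absKernel_eq_bot_or_top hpos hirr (fun _ : Unit => L) (fun _ => hL)
    (fun S hS y _ _ => hN S hS |y|) with h | h
  · obtain ⟨S, hS, hS0⟩ := hne
    refine hS0 (ContinuousLinearMap.ext fun y => ?_)
    have : S y ∈ absKernel (fun _ : Unit => L) (fun _ => hL) := fun _ =>
      apply_eq_zero_of_le hL (abs_nonneg _) ((hpos S hS).abs_apply_le y) (hN S hS _)
    rwa [h, Submodule.mem_bot] at this
  · refine hL0 (ContinuousLinearMap.ext fun y => ?_)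
    have : y ∈ absKernel (fun _ : Unit => L) (fun _ => hL) := h ▸ Submodule.mem_top
    exact apply_eq_zero_of_apply_abs hL (this ())

end Irreducible

section Disjoint

theorem nonneg_of_inf_eq_zero {a b : X} (h : a ⊓ b = 0) : 0 ≤ a ∧ 0 ≤ b :=
  ⟨h ▸ inf_le_left, h ▸ inf_le_right⟩

theorem inf_eq_zero_of_le {a b c d : X} (h : a ⊓ b = 0) (hc : 0 ≤ c) (hd : 0 ≤ d)
    (hca : c ≤ a) (hdb : d ≤ b) : c ⊓ d = 0 :=
  le_antisymm ((inf_le_inf hca hdb).trans h.le) (le_inf hc hd)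

theorem inf_add_eq_zero {a b c : X} (hb : a ⊓ b = 0) (hc : a ⊓ c = 0) : a ⊓ (b + c) = 0 := by
  have ha := (nonneg_of_inf_eq_zero hb).1
  have hb0 := (nonneg_of_inf_eq_zero hb).2
  have hc0 := (nonneg_of_inf_eq_zero hc).2
  refine le_antisymm ?_ (le_inf ha (add_nonneg hb0 hc0))
  have h1 : a ⊓ (b + c) - b ≤ a ⊓ c :=
    le_inf ((sub_le_self _ hb0).trans inf_le_left) (sub_le_iff_le_add'.2 inf_le_right)
  rw [hc, sub_nonpos] at h1
  exact (le_inf inf_le_left h1).trans hb.le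

theorem inf_smul_eq_zero {a b : X} {c : ℝ} (hc : 0 ≤ c) (h : a ⊓ b = 0) : a ⊓ c • b = 0 := by
  obtain ⟨ha, hb⟩ := nonneg_of_inf_eq_zero h
  have hM : (0 : ℝ) < max 1 c := lt_max_of_lt_left one_pos
  refine le_antisymm ?_ (le_inf ha (smul_nonneg hc hb))
  have h1 : (max 1 c)⁻¹ • (a ⊓ c • b) ≤ a ⊓ b := by
    refine le_inf ?_ ?_
    · rw [inv_smul_le_iff_of_pos hM]
      refine inf_le_left.trans ?_
      simpa using smul_le_smul_of_nonneg_right (le_max_left 1 c) ha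
    · rw [inv_smul_le_iff_of_pos hM]
      exact inf_le_right.trans (smul_le_smul_of_nonneg_right (le_max_right 1 c) hb)
  rw [h, inv_smul_le_iff_of_pos hM, smul_zero] at h1
  exact h1

theorem inf_sum_eq_zero {ι : Type*} {s : Finset ι} {a : X} {x : ι → X} (ha : 0 ≤ a)
    (h : ∀ i ∈ s, a ⊓ x i = 0) : a ⊓ ∑ i ∈ s, x i = 0 := by
  classical
  induction s using Finset.induction_on with
  | empty => simpa using ha
  | insert i s hi ih =>
    rw [Finset.sum_insert hi]
    exact inf_add_eq_zero (h i (Finset.mem_insert_self i s))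
      (ih fun j hj => h j (Finset.mem_insert_of_mem hj))

/-- Coordinates with respect to disjoint positive vectors are positive functionals. -/
theorem nonneg_coord_of_disjoint {ι : Type*} {s : Finset ι} {x : ι → X} (hx : ∀ i ∈ s, 0 < x i)
    (hd : ∀ i ∈ s, ∀ j ∈ s, i ≠ j → x i ⊓ x j = 0) {a : ι → ℝ} (h : 0 ≤ ∑ i ∈ s, a i • x i)
    {i : ι} (hi : i ∈ s) : 0 ≤ a i := by
  classical
  by_contra! hai
  have h1 : (-a i) • x i ≤ ∑ j ∈ s.erase i, |a j| • x j := by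
    rw [← Finset.add_sum_erase s _ hi, add_comm, ← neg_le_iff_add_nonneg, ← neg_smul] at h
    refine h.trans (Finset.sum_le_sum fun j hj => ?_)
    exact smul_le_smul_of_nonneg_right (le_abs_self _) (hx j (Finset.mem_of_mem_erase hj)).le
  have h2 : x i ⊓ ∑ j ∈ s.erase i, |a j| • x j = 0 :=
    inf_sum_eq_zero (hx i hi).le fun j hj => inf_smul_eq_zero (abs_nonneg _)
      (hd i hi j (Finset.mem_of_mem_erase hj) (Finset.ne_of_mem_erase hj).symm)
  have h3 := inf_smul_eq_zero (neg_pos.2 hai).le ((inf_comm _ _).trans h2)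
  rw [inf_eq_right.2 h1] at h3
  rcases smul_eq_zero.1 h3 with h4 | h4
  · linarith
  · exact (hx i hi).ne' h4

theorem eq_zero_of_disjoint_of_sum_eq_zero {ι : Type*} {s : Finset ι} {x : ι → X}
    (hx : ∀ i ∈ s, 0 < x i) (hd : ∀ i ∈ s, ∀ j ∈ s, i ≠ j → x i ⊓ x j = 0) {a : ι → ℝ}
    (h : ∑ i ∈ s, a i • x i = 0) {i : ι} (hi : i ∈ s) : a i = 0 := by
  refine le_antisymm ?_ (nonneg_coord_of_disjoint hx hd h.ge hi)
  have : 0 ≤ ∑ i ∈ s, (-a i) • x i := by simp [neg_smul, h]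
  exact neg_nonneg.1 (nonneg_coord_of_disjoint hx hd this hi)

end Disjoint

end Lattice

end PosSemigroup

namespace PosSemigroup

/-! ### Finite-dimensional sublattices have disjoint positive bases -/

section Sublattice

variable {X : Type*} [NormedAddCommGroup X] [NormedSpace ℝ X] [Lattice X] [IsOrderedAddMonoid X]
  [IsOrderedModule ℝ X] [HasSolidNorm X]

/-- A finite set of nonzero, positive, pairwise disjoint vectors in `Y`. -/
structure IsDisjointSystem (Y : Submodule ℝ X) (s : Finset X) : Prop where
  mem : ∀ x ∈ s, x ∈ Y
  pos : ∀ x ∈ s, 0 < x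
  disjoint : ∀ x ∈ s, ∀ y ∈ s, x ≠ y → x ⊓ y = 0

theorem IsDisjointSystem.linearIndepOn {Y : Submodule ℝ X} {s : Finset X}
    (hs : IsDisjointSystem Y s) : LinearIndepOn ℝ id (s : Set X) :=
  linearIndepOn_finset_iff.2 fun _ h _ hi =>
    eq_zero_of_disjoint_of_sum_eq_zero (x := id) hs.pos hs.disjoint h hi

theorem IsDisjointSystem.card_le {Y : Submodule ℝ X} [FiniteDimensional ℝ Y] {s : Finset X}
    (hs : IsDisjointSystem Y s) : s.card ≤ Module.finrank ℝ Y := by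
  have := finrank_span_finset_eq_card (R := ℝ) (s := s) hs.linearIndepOn
  rw [← this]
  exact Submodule.finrank_mono (Submodule.span_le.2 fun x hx => hs.mem x hx)

theorem sup_mem_of_abs_mem {Y : Submodule ℝ X} (hY : ∀ y ∈ Y, |y| ∈ Y) {a b : X} (ha : a ∈ Y)
    (hb : b ∈ Y) : a ⊔ b ∈ Y := by
  rw [sup_eq_half_smul_add_add_abs_sub' ℝ]
  exact Y.smul_mem _ (Y.add_mem (Y.add_mem ha hb) (hY _ (Y.sub_mem hb ha)))

theorem inf_mem_of_abs_mem {Y : Submodule ℝ X} (hY : ∀ y ∈ Y, |y| ∈ Y) {a b : X} (ha : a ∈ Y)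
    (hb : b ∈ Y) : a ⊓ b ∈ Y := by
  rw [inf_eq_half_smul_add_sub_abs_sub' ℝ]
  exact Y.smul_mem _ (Y.sub_mem (Y.add_mem ha hb) (hY _ (Y.sub_mem hb ha)))

/-- Connectedness of `[0, 1]`: the closed sets of `t` with `u ≤ t • x` and with `t • x ≤ u` cover it
and both meet it, so they share a point. -/
theorem exists_eq_smul_of_comparable {x u : X} (h0 : 0 ≤ u) (h1 : u ≤ x)
    (h : ∀ t ∈ Set.Icc (0 : ℝ) 1, u ≤ t • x ∨ t • x ≤ u) : ∃ t : ℝ, u = t • x := by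
  have hcont : Continuous fun t : ℝ => t • x := continuous_id.smul continuous_const
  obtain ⟨t, -, ht1, ht2⟩ := isPreconnected_closed_iff.1 (isPreconnected_Icc (a := (0 : ℝ)) (b := 1))
    {t | u ≤ t • x} {t | t • x ≤ u} (isClosed_le continuous_const hcont)
    (isClosed_le hcont continuous_const) h ⟨1, by simp, by simpa using h1⟩
    ⟨0, by simp, by simpa using h0⟩
  exact ⟨t, le_antisymm ht1 ht2⟩

/-- A member of a disjoint system of maximal size is an atom. -/
theorem IsDisjointSystem.exists_eq_smul {Y : Submodule ℝ X} (hY : ∀ y ∈ Y, |y| ∈ Y)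
    {s : Finset X} (hs : IsDisjointSystem Y s)
    (hmax : ∀ s', IsDisjointSystem Y s' → s'.card ≤ s.card) {x u : X} (hx : x ∈ s) (hu : u ∈ Y)
    (h0 : 0 ≤ u) (h1 : u ≤ x) : ∃ t : ℝ, u = t • x := by
  classical
  refine exists_eq_smul_of_comparable h0 h1 ?_
  by_contra! hcon
  -- For a `t` with `u` and `t • x` incomparable, both parts of `u - t • x` are nonzero. They are
  -- disjoint and below `x`, so replacing `x` by the two of them enlarges the system.
  obtain ⟨t, ht, hp, hq⟩ := hcon
  have hxY := hs.mem x hx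
  have hx0 := hs.pos x hx
  have hdY : u - t • x ∈ Y := Y.sub_mem hu (Y.smul_mem _ hxY)
  set p := (u - t • x)⁺ with hpdef
  set q := (u - t • x)⁻ with hqdef
  have hpY : p ∈ Y := sup_mem_of_abs_mem hY hdY Y.zero_mem
  have hqY : q ∈ Y := sup_mem_of_abs_mem hY (Y.neg_mem hdY) Y.zero_mem
  have hpq : p ⊓ q = 0 := posPart_inf_negPart_eq_zero _
  have hp0 : 0 < p := (posPart_nonneg _).lt_of_ne' fun h =>
    hp (sub_nonpos.1 (posPart_eq_zero.1 h))
  have hq0 : 0 < q := (negPart_nonneg _).lt_of_ne' fun h =>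
    hq (sub_nonneg.1 (negPart_eq_zero.1 h))
  have hpx : p ≤ x := sup_le ((sub_le_self _ (smul_nonneg ht.1 hx0.le)).trans h1) hx0.le
  have hqx : q ≤ x := by
    refine sup_le ?_ hx0.le
    rw [neg_sub]
    refine (sub_le_self _ h0).trans ?_
    simpa using smul_le_smul_of_nonneg_right ht.2 hx0.le
  have hpe : ∀ y ∈ s.erase x, p ⊓ y = 0 := fun y hy =>
    inf_eq_zero_of_le (hs.disjoint x hx y (Finset.mem_of_mem_erase hy)
      (Finset.ne_of_mem_erase hy).symm) hp0.le (hs.pos y (Finset.mem_of_mem_erase hy)).le hpx le_rfl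
  have hqe : ∀ y ∈ s.erase x, q ⊓ y = 0 := fun y hy =>
    inf_eq_zero_of_le (hs.disjoint x hx y (Finset.mem_of_mem_erase hy)
      (Finset.ne_of_mem_erase hy).symm) hq0.le (hs.pos y (Finset.mem_of_mem_erase hy)).le hqx le_rfl
  have hqn : q ∉ s.erase x := fun h => hq0.ne' (by simpa using hqe q h)
  have hpn : p ∉ insert q (s.erase x) := by
    intro h
    rcases Finset.mem_insert.1 h with h | h
    · rw [← h, inf_idem] at hpq
      exact hp0.ne' hpq
    · exact hp0.ne' (by simpa using hpe p h)
  have hnew : IsDisjointSystem Y (insert p (insert q (s.erase x))) := by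
    refine ⟨?_, ?_, ?_⟩
    · intro y hy
      rcases Finset.mem_insert.1 hy with rfl | hy
      · exact hpY
      rcases Finset.mem_insert.1 hy with rfl | hy
      · exact hqY
      exact hs.mem y (Finset.mem_of_mem_erase hy)
    · intro y hy
      rcases Finset.mem_insert.1 hy with rfl | hy
      · exact hp0
      rcases Finset.mem_insert.1 hy with rfl | hy
      · exact hq0
      exact hs.pos y (Finset.mem_of_mem_erase hy)
    · intro y hy z hz hyz
      rcases Finset.mem_insert.1 hy with hy | hy
      · rcases Finset.mem_insert.1 hz with hz | hz
        · exact absurd (hy.trans hz.symm) hyz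
        rcases Finset.mem_insert.1 hz with hz | hz
        · rw [hy, hz, hpq]
        · rw [hy, hpe z hz]
      rcases Finset.mem_insert.1 hy with hy | hy
      · rcases Finset.mem_insert.1 hz with hz | hz
        · rw [hy, hz, inf_comm, hpq]
        rcases Finset.mem_insert.1 hz with hz | hz
        · exact absurd (hy.trans hz.symm) hyz
        · rw [hy, hqe z hz]
      · rcases Finset.mem_insert.1 hz with hz | hz
        · rw [hz, inf_comm, hpe y hy]
        rcases Finset.mem_insert.1 hz with hz | hz
        · rw [hz, inf_comm, hqe y hy]
        · exact hs.disjoint y (Finset.mem_of_mem_erase hy) z (Finset.mem_of_mem_erase hz) hyz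
  have := hmax _ hnew
  rw [Finset.card_insert_of_notMem hpn, Finset.card_insert_of_notMem hqn,
    Finset.card_erase_add_one hx] at this
  omega

theorem sum_le_of_disjoint {ι : Type*} {s : Finset ι} {x : ι → X} {y : X} (hy : 0 ≤ y)
    (hx : ∀ i ∈ s, 0 ≤ x i) (hd : ∀ i ∈ s, ∀ j ∈ s, i ≠ j → x i ⊓ x j = 0)
    (h : ∀ i ∈ s, x i ≤ y) : ∑ i ∈ s, x i ≤ y := by
  classical
  induction s using Finset.induction_on with
  | empty => simpa using hy
  | insert i s hi ih =>
    rw [Finset.sum_insert hi]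
    have h1 : x i ⊓ ∑ j ∈ s, x j = 0 :=
      inf_sum_eq_zero (hx i (Finset.mem_insert_self i s)) fun j hj =>
        hd i (Finset.mem_insert_self i s) j (Finset.mem_insert_of_mem hj)
          (fun hij => hi (hij ▸ hj))
    rw [← inf_add_sup, h1, zero_add]
    refine sup_le (h i (Finset.mem_insert_self i s)) (ih ?_ ?_ ?_)
    · exact fun j hj => hx j (Finset.mem_insert_of_mem hj)
    · exact fun j hj k hk => hd j (Finset.mem_insert_of_mem hj) k (Finset.mem_insert_of_mem hk)
    · exact fun j hj => h j (Finset.mem_insert_of_mem hj)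

/-- If `[0, n x] ∩ Y` consists of multiples of `x`, then every positive vector of `Y` is the sum of
a multiple of `x` and a positive vector disjoint from `x`. -/
theorem exists_smul_le_and_disjoint {Y : Submodule ℝ X} (hY : ∀ y ∈ Y, |y| ∈ Y) {x : X}
    (hxY : x ∈ Y) (hx0 : 0 < x) (hat : ∀ u ∈ Y, 0 ≤ u → u ≤ x → ∃ t : ℝ, u = t • x)
    {y : X} (hyY : y ∈ Y) (hy : 0 ≤ y) :
    ∃ t : ℝ, 0 ≤ t ∧ t • x ≤ y ∧ (y - t • x) ⊓ x = 0 := by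
  -- With `n` this large, `y ⊓ n • x = t • x` forces `t < n` by comparing norms. Then `(y - t • x) ⊓
  -- (n - t) • x = 0` has a positive factor that can be cancelled.
  obtain ⟨n, hn⟩ := exists_nat_gt (‖y‖ / ‖x‖)
  have hxn : 0 < ‖x‖ := norm_pos_iff.2 hx0.ne'
  have hn0 : (0 : ℝ) < n := lt_of_le_of_lt (by positivity) hn
  obtain ⟨t', ht'⟩ := hat ((n : ℝ)⁻¹ • (y ⊓ (n : ℝ) • x))
    (Y.smul_mem _ (inf_mem_of_abs_mem hY hyY (Y.smul_mem _ hxY)))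
    (smul_nonneg (by positivity) (le_inf hy (smul_nonneg hn0.le hx0.le)))
    (by rw [inv_smul_le_iff_of_pos hn0]; exact inf_le_right)
  have hinf : y ⊓ (n : ℝ) • x = (n * t') • x := by
    rw [mul_smul, ← ht', smul_inv_smul₀ hn0.ne']
  set t := n * t' with ht
  have hle : t • x ≤ y := hinf ▸ inf_le_left
  have ht0 : 0 ≤ t := by
    have h1 : 0 ≤ t • x := hinf ▸ le_inf hy (smul_nonneg hn0.le hx0.le)
    by_contra! hneg
    have h2 : 0 ≤ (-t) • x := smul_nonneg (by linarith) hx0.le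
    rw [neg_smul, Left.nonneg_neg_iff] at h2
    rcases smul_eq_zero.1 (le_antisymm h2 h1) with h | h
    · exact hneg.ne h
    · exact hx0.ne' h
  have htn : t < n := by
    have h1 : ‖t • x‖ ≤ ‖y‖ := norm_le_norm_of_abs_le_abs (by
      rwa [abs_of_nonneg hy, abs_of_nonneg (smul_nonneg ht0 hx0.le)])
    rw [norm_smul, Real.norm_of_nonneg ht0] at h1
    exact lt_of_le_of_lt ((le_div_iff₀ hxn).2 h1) hn
  refine ⟨t, ht0, hle, ?_⟩
  have h1 : (y - t • x) ⊓ (n - t) • x = 0 := by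
    rw [sub_smul, ← inf_sub, hinf, sub_self]
  have h2 := inf_smul_eq_zero (inv_nonneg.2 (sub_pos.2 htn).le) h1
  rwa [inv_smul_smul₀ (sub_pos.2 htn).ne'] at h2

/-- A finite-dimensional vector sublattice is spanned by disjoint positive vectors. -/
theorem exists_disjointSystem_span_eq {Y : Submodule ℝ X} [FiniteDimensional ℝ Y]
    (hY : ∀ y ∈ Y, |y| ∈ Y) :
    ∃ s : Finset X, IsDisjointSystem Y s ∧ Submodule.span ℝ (s : Set X) = Y := by
  classical
  obtain ⟨s, hs, hmax⟩ : ∃ s, IsDisjointSystem Y s ∧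
      ∀ s', IsDisjointSystem Y s' → s'.card ≤ s.card := by
    have hbdd : BddAbove (Finset.card '' {s | IsDisjointSystem Y s}) :=
      ⟨Module.finrank ℝ Y, by rintro _ ⟨s, hs, rfl⟩; exact hs.card_le⟩
    have hne : (Finset.card '' {s | IsDisjointSystem Y s}).Nonempty :=
      ⟨_, ∅, ⟨by simp, by simp, by simp⟩, rfl⟩
    obtain ⟨s, hs, hcard⟩ := Nat.sSup_mem hne hbdd
    exact ⟨s, hs, fun s' hs' => hcard ▸ le_csSup hbdd ⟨s', hs', rfl⟩⟩
  refine ⟨s, hs, le_antisymm (Submodule.span_le.2 fun x hx => hs.mem x hx) ?_⟩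
  have hposmem : ∀ y ∈ Y, 0 ≤ y → y ∈ Submodule.span ℝ (s : Set X) := by
    intro y hyY hy
    have key : ∀ x : X, ∃ t : ℝ, x ∈ s → 0 ≤ t ∧ t • x ≤ y ∧ (y - t • x) ⊓ x = 0 := by
      intro x
      by_cases hx : x ∈ s
      · obtain ⟨t, ht⟩ := exists_smul_le_and_disjoint hY (hs.mem x hx) (hs.pos x hx)
          (fun u hu h0 h1 => hs.exists_eq_smul hY hmax hx hu h0 h1) hyY hy
        exact ⟨t, fun _ => ht⟩
      · exact ⟨0, fun h => absurd h hx⟩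
    choose t ht using key
    have hsum : ∑ x ∈ s, t x • x ∈ Submodule.span ℝ (s : Set X) :=
      Submodule.sum_mem _ fun x hx => Submodule.smul_mem _ _ (Submodule.subset_span hx)
    have hsumY : ∑ x ∈ s, t x • x ∈ Y :=
      Submodule.sum_mem _ fun x hx => Submodule.smul_mem _ _ (hs.mem x hx)
    have hnn : ∀ x ∈ s, 0 ≤ t x • x := fun x hx => smul_nonneg (ht x hx).1 (hs.pos x hx).le
    have hle : ∑ x ∈ s, t x • x ≤ y := by
      refine sum_le_of_disjoint hy hnn (fun x hx z hz hxz => ?_) fun x hx => (ht x hx).2.1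
      refine inf_smul_eq_zero (ht z hz).1 ?_
      rw [inf_comm]
      refine inf_smul_eq_zero (ht x hx).1 ?_
      rw [inf_comm]
      exact hs.disjoint x hx z hz hxz
    suffices h : y - ∑ x ∈ s, t x • x = 0 by
      rw [sub_eq_zero.1 h]
      exact hsum
    by_contra hne
    -- A nonzero remainder is disjoint from the whole system and could be added to it, against
    -- maximality.
    set w := y - ∑ x ∈ s, t x • x with hw
    have hw0 : 0 < w := (sub_nonneg.2 hle).lt_of_ne' hne
    have hwd : ∀ x ∈ s, w ⊓ x = 0 := fun x hx =>
      inf_eq_zero_of_le (ht x hx).2.2 hw0.le (hs.pos x hx).le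
        (sub_le_sub_left (Finset.single_le_sum (f := fun x => t x • x) hnn hx) y) le_rfl
    have hwn : w ∉ s := fun h => hw0.ne' (by simpa using hwd w h)
    have hnew : IsDisjointSystem Y (insert w s) := by
      refine ⟨?_, ?_, ?_⟩
      · intro z hz
        rcases Finset.mem_insert.1 hz with hz | hz
        · exact hz ▸ Y.sub_mem hyY hsumY
        · exact hs.mem z hz
      · intro z hz
        rcases Finset.mem_insert.1 hz with hz | hz
        · exact hz ▸ hw0
        · exact hs.pos z hz
      · intro a ha b hb hab
        rcases Finset.mem_insert.1 ha with ha | ha <;> rcases Finset.mem_insert.1 hb with hb | hb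
        · exact absurd (ha.trans hb.symm) hab
        · rw [ha, hwd b hb]
        · rw [hb, inf_comm, hwd a ha]
        · exact hs.disjoint a ha b hb hab
    have := hmax _ hnew
    rw [Finset.card_insert_of_notMem hwn] at this
    omega
  intro y hy
  rw [← posPart_sub_negPart y]
  exact Submodule.sub_mem _
    (hposmem _ (sup_mem_of_abs_mem hY hy Y.zero_mem) (posPart_nonneg y))
    (hposmem _ (sup_mem_of_abs_mem hY (Y.neg_mem hy) Y.zero_mem) (negPart_nonneg y))

end Sublattice

end PosSemigroup

namespace PosSemigroup

open Filter Topology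

/-! ### Inverses by compactness -/

section ClosedSemigroup

/-- In a closed multiplicative subset of a finite-dimensional algebra which is stable under
positive scalars and whose nonzero elements are units, inverses stay in the set. -/
theorem exists_inverse_mem_of_isClosed {E : Type*} [NormedRing E] [NormedAlgebra ℝ E]
    [ProperSpace E] {G : Set E} (hG : IsClosed G) (hmul : ∀ a ∈ G, ∀ b ∈ G, a * b ∈ G)
    (hsmul : ∀ a ∈ G, ∀ c : ℝ, 0 < c → c • a ∈ G) (hunit : ∀ a ∈ G, a ≠ 0 → IsUnit a)
    {B : E} (hB : B ∈ G) (hB0 : B ≠ 0) : ∃ C ∈ G, C * B = 1 ∧ B * C = 1 := by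
  have : Nontrivial E := nontrivial_of_ne _ _ hB0
  obtain ⟨U, rfl⟩ := hunit B hB hB0
  set B : E := (U : E)
  have hpow : ∀ n : ℕ, B ^ (n + 1) ∈ G := by
    intro n
    induction n with
    | zero => simpa using hB
    | succ n ih => rw [pow_succ]; exact hmul _ ih _ hB
  have hnorm : ∀ n : ℕ, 0 < ‖B ^ n‖ := fun n => norm_pos_iff.2 (U.isUnit.pow n).ne_zero
  set u : ℕ → E := fun n => ‖B ^ n‖⁻¹ • B ^ n with hu
  have hus : ∀ n, u n ∈ Metric.sphere (0 : E) 1 := fun n => by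
    simp [hu, norm_smul, (hnorm n).ne']
  obtain ⟨C, hC, φ, hφ, hlim⟩ := (isCompact_sphere (0 : E) 1).tendsto_subseq hus
  have hC0 : C ≠ 0 := fun h => by simp [h] at hC
  have hCG : C ∈ G := by
    refine hG.mem_of_tendsto hlim ((eventually_ge_atTop 1).mono fun k hk => ?_)
    obtain ⟨m, hm⟩ := Nat.exists_eq_add_of_le' (hk.trans (hφ.id_le k))
    simp only [Function.comp, hu]
    rw [hm]
    exact hsmul _ (hpow m) _ (inv_pos.2 (hm ▸ hnorm (φ k)))
  obtain ⟨V, rfl⟩ := hunit C hCG hC0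
  -- The limit of the normalised powers is a unit, so consecutive ratios tend to 1. As `φ` is
  -- strictly increasing, each ratio is a positive multiple of a power with exponent at least 1, so
  -- it lies in `G`.
  have hD : Tendsto (fun k => u (φ (k + 1)) * Ring.inverse (u (φ k))) atTop (𝓝 1) := by
    have h1 := (hlim.comp (tendsto_add_atTop_nat 1)).mul
      ((NormedRing.inverse_continuousAt V).tendsto.comp hlim)
    simpa using h1
  have hDeq : ∀ k, ∃ (a : ℝ) (m : ℕ), 0 < a ∧
      u (φ (k + 1)) * Ring.inverse (u (φ k)) = a • B ^ (m + 1) := by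
    intro k
    obtain ⟨m, hm⟩ := Nat.exists_eq_add_of_lt (hφ (Nat.lt_succ_self k))
    refine ⟨‖B ^ φ (k + 1)‖⁻¹ * ‖B ^ φ k‖, m, mul_pos (inv_pos.2 (hnorm _)) (hnorm _), ?_⟩
    have huu : IsUnit (u (φ k)) :=
      ⟨Units.mk0 _ (inv_pos.2 (hnorm (φ k))).ne' • U ^ φ k, by simp [hu, B, Units.smul_def]⟩
    apply huu.mul_right_cancel
    rw [Ring.inverse_mul_cancel_right _ _ huu]
    simp only [hu, smul_mul_smul_comm, ← pow_add]
    rw [mul_assoc, mul_inv_cancel₀ (hnorm _).ne', mul_one, Nat.succ_eq_add_one] at *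
    congr 2
    omega
  choose a m ha hDe using hDeq
  have h1G : (1 : E) ∈ G := hG.mem_of_tendsto hD (Eventually.of_forall fun k => by
    rw [hDe]; exact hsmul _ (hpow _) _ (ha k))
  refine ⟨(U⁻¹ : Eˣ), ?_, U.inv_mul, U.mul_inv⟩
  have hlim2 := hD.mul_const ((U⁻¹ : Eˣ) : E)
  rw [one_mul] at hlim2
  refine hG.mem_of_tendsto hlim2 (Eventually.of_forall fun k => ?_)
  rw [hDe, smul_mul_assoc, pow_succ, mul_assoc, U.mul_inv, mul_one]
  refine hsmul _ ?_ _ (ha k)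
  -- After multiplication by the inverse of `B` the exponent may drop to 0; this is why `1 ∈ G` was
  -- established first.
  rcases m k with _ | n
  · simpa using h1G
  · exact hpow n

end ClosedSemigroup

/-! ### Operators of minimal rank -/

section MinimalRank

variable {X : Type*} [NormedAddCommGroup X] [NormedSpace ℝ X]

theorem finiteDimensional_range_of_opRank_le {S : X →L[ℝ] X} {r : ℕ} (h : opRank S ≤ r) :
    FiniteDimensional ℝ (LinearMap.range (S : X →ₗ[ℝ] X)) := by
  have h1 : Module.rank ℝ (LinearMap.range (S : X →ₗ[ℝ] X)) ≤ r := Cardinal.toENat_le_natCast.1 h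
  exact Module.rank_lt_aleph0_iff.1 (h1.trans_lt (Cardinal.natCast_lt_aleph0))

theorem opRank_eq_finrank (S : X →L[ℝ] X)
    [FiniteDimensional ℝ (LinearMap.range (S : X →ₗ[ℝ] X))] :
    opRank S = Module.finrank ℝ (LinearMap.range (S : X →ₗ[ℝ] X)) := by
  rw [opRank, LinearMap.rank, ← Module.finrank_eq_rank]
  simp

theorem finrank_range_of_opRank_eq {S : X →L[ℝ] X} {r : ℕ} (h : opRank S = r) :
    Module.finrank ℝ (LinearMap.range (S : X →ₗ[ℝ] X)) = r := by
  have := finiteDimensional_range_of_opRank_le h.le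
  rw [opRank_eq_finrank] at h
  exact_mod_cast h

variable [Lattice X] {𝒮 : Subsemigroup (X →L[ℝ] X)} {r : ℕ}

theorem le_opRank_of_minRank_eq (hr : minRank 𝒮 = r) {S : X →L[ℝ] X} (hS : S ∈ 𝒮) (hS0 : S ≠ 0) :
    (r : ℕ∞) ≤ opRank S := hr ▸ iInf₂_le S ⟨hS, hS0⟩

theorem exists_opRank_eq_minRank (hr : minRank 𝒮 = r) : ∃ S ∈ 𝒮, S ≠ 0 ∧ opRank S = r := by
  by_contra! h
  have h1 : (r : ℕ∞) + 1 ≤ minRank 𝒮 := le_iInf₂ fun S hS => Order.add_one_le_of_lt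
    ((le_opRank_of_minRank_eq hr hS.1 hS.2).lt_of_ne' (h S hS.1 hS.2))
  rw [hr] at h1
  exact absurd h1 (by exact_mod_cast Nat.not_succ_le_self r)

theorem range_eq_of_le_of_minRank_eq (hr : minRank 𝒮 = r) {S : X →L[ℝ] X} (hS : S ∈ 𝒮)
    (hS0 : S ≠ 0) {V : Submodule ℝ X} [FiniteDimensional ℝ V] (hV : Module.finrank ℝ V ≤ r)
    (h : LinearMap.range (S : X →ₗ[ℝ] X) ≤ V) : LinearMap.range (S : X →ₗ[ℝ] X) = V := by
  have := Submodule.finiteDimensional_of_le h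
  refine Submodule.eq_of_le_of_finrank_le h (hV.trans ?_)
  have := le_opRank_of_minRank_eq hr hS hS0
  rw [opRank_eq_finrank] at this
  exact_mod_cast this

theorem opRank_mul_le_left (S T : X →L[ℝ] X) : opRank (S * T) ≤ opRank S :=
  OrderHomClass.mono Cardinal.toENat (LinearMap.rank_comp_le_left (T : X →ₗ[ℝ] X) (S : X →ₗ[ℝ] X))

theorem opRank_mul_le_right (S T : X →L[ℝ] X) : opRank (S * T) ≤ opRank T :=
  OrderHomClass.mono Cardinal.toENat (LinearMap.rank_comp_le_right (T : X →ₗ[ℝ] X) (S : X →ₗ[ℝ] X))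

/-- An operator of minimal rank in a closed semigroup which is injective on its range gives rise
to a projection with the same range and to an inverse on this range. -/
theorem exists_projection_and_inverse (hclosed : IsRPlusClosed 𝒮) (hr : minRank 𝒮 = r)
    {A : X →L[ℝ] X} (hA : A ∈ 𝒮) (hA0 : A ≠ 0) (hAr : opRank A ≤ r)
    (hinj : ∀ v ∈ LinearMap.range (A : X →ₗ[ℝ] X), A v = 0 → v = 0) :
    (∃ P ∈ rankProjections 𝒮 r,
      LinearMap.range (P : X →ₗ[ℝ] X) = LinearMap.range (A : X →ₗ[ℝ] X) ∧
      ∀ z, A z = 0 ↔ P z = 0) ∧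
    ∃ A' ∈ 𝒮, ∀ v ∈ LinearMap.range (A : X →ₗ[ℝ] X), A' (A v) = v := by
  have hArk : opRank A = r := le_antisymm hAr (le_opRank_of_minRank_eq hr hA hA0)
  have hfin := finiteDimensional_range_of_opRank_le hAr
  have hfr := finrank_range_of_opRank_eq hArk
  set V := LinearMap.range (A : X →ₗ[ℝ] X) with hV
  let J : V →L[ℝ] X := V.subtypeL
  let A₁ : X →L[ℝ] V := A.codRestrict V fun x => ⟨x, rfl⟩
  let B : V →L[ℝ] V := A₁.comp J
  have hBinj : Function.Injective (B : V →ₗ[ℝ] V) := by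
    rw [← LinearMap.ker_eq_bot, LinearMap.ker_eq_bot']
    exact fun v hv => Subtype.ext (hinj v v.2 (congrArg Subtype.val hv))
  let e : V ≃L[ℝ] V := (LinearEquiv.ofInjectiveEndo (B : V →ₗ[ℝ] V) hBinj).toContinuousLinearEquiv
  have he : ∀ v, e v = B v := fun v => rfl
  let Q : X →L[ℝ] V := (e.symm : V →L[ℝ] V).comp A₁
  have hQJ : ∀ v : V, Q v = v := fun v => by
    change e.symm (B v) = v
    rw [← he, e.symm_apply_apply]
  have hBQ : ∀ x, B (Q x) = A₁ x := fun x => by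
    rw [← he]; exact e.apply_symm_apply _
  -- `Q` is the projection onto `V` along the kernel of `A`, so `Φ` is multiplicative, injective,
  -- and sends `B` to `A`. Pulling the semigroup back along `Φ` moves the problem to a
  -- finite-dimensional algebra, where minimality of the rank makes nonzero elements units.
  let Φ : (V →L[ℝ] V) → (X →L[ℝ] X) := fun C => J.comp (C.comp Q)
  have hΦ : ∀ C x, Φ C x = (C (Q x) : X) := fun C x => rfl
  have hΦmul : ∀ C D, Φ (C * D) = Φ C * Φ D := fun C D => by
    ext x
    simp [hΦ, hQJ]
  have hΦcont : Continuous Φ :=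
    continuous_const.clm_comp (continuous_id.clm_comp continuous_const)
  have hΦB : Φ B = A := by
    ext x
    rw [hΦ, hBQ]
    rfl
  have hΦ0 : ∀ C, Φ C = 0 → C = 0 := fun C hC => by
    ext v
    have := DFunLike.congr_fun hC (v : X)
    rw [hΦ, hQJ] at this
    simpa using this
  have : ProperSpace (V →L[ℝ] V) := FiniteDimensional.proper_real (V →L[ℝ] V)
  have hB0 : B ≠ 0 := fun h => hA0 (by rw [← hΦB, h]; ext x; simp [hΦ])
  obtain ⟨C, hC, hCB, hBC⟩ := exists_inverse_mem_of_isClosed (G := Φ ⁻¹' (𝒮 : Set (X →L[ℝ] X)))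
    (hclosed.1.preimage hΦcont)
    (fun C hC D hD => by
      change Φ (C * D) ∈ 𝒮
      rw [hΦmul]; exact 𝒮.mul_mem hC hD)
    (fun C hC c hc => by
      have : Φ (c • C) = c • Φ C := by ext x; simp [hΦ]
      change Φ (c • C) ∈ 𝒮
      rw [this]; exact hclosed.2 _ hC c hc)
    (fun C hC hC0 => by
      have hrange := range_eq_of_le_of_minRank_eq hr hC (fun h => hC0 (hΦ0 C h)) hfr.le
        (by rintro _ ⟨x, rfl⟩; exact (C (Q x)).2)
      have hsurj : Function.Surjective (C : V →ₗ[ℝ] V) := by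
        intro v
        have hv : (v : X) ∈ LinearMap.range (Φ C : X →ₗ[ℝ] X) := by
          rw [hrange]
          exact v.2
        obtain ⟨x, hx⟩ := hv
        exact ⟨Q x, Subtype.ext hx⟩
      exact ContinuousLinearMap.isUnit_iff_bijective.2
        ⟨LinearMap.injective_iff_surjective.2 hsurj, hsurj⟩)
    (show Φ B ∈ 𝒮 by rw [hΦB]; exact hA) hB0
  have hP : Φ 1 ∈ 𝒮 := by
    rw [← hCB, hΦmul, hΦB]
    exact 𝒮.mul_mem hC hA
  have hΦ1 : ∀ x, Φ 1 x = Q x := fun x => rfl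
  have hPrange : LinearMap.range (Φ 1 : X →ₗ[ℝ] X) = V := by
    ext v
    constructor
    · rintro ⟨x, rfl⟩
      exact (Q x).2
    · intro hv
      exact ⟨v, congrArg Subtype.val (hQJ ⟨v, hv⟩)⟩
  refine ⟨⟨Φ 1, ⟨hP, by rw [← hΦmul, one_mul], ?_⟩, hPrange, fun z => ⟨fun hz => ?_, fun hz => ?_⟩⟩, Φ C, hC, ?_⟩
  · rw [opRank, LinearMap.rank, hPrange]
    exact hArk
  · have hA1 : A₁ z = 0 := Subtype.ext hz
    have hQz : Q z = 0 := by
      change e.symm (A₁ z) = 0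
      rw [hA1, map_zero]
    rw [hΦ1, hQz]
    rfl
  · have hQz : Q z = 0 := Subtype.ext hz
    have hA1 : A₁ z = 0 := by rw [← hBQ, hQz, map_zero]
    exact congrArg Subtype.val hA1
  · intro v hv
    have h1 : A v = ((B ⟨v, hv⟩ : V) : X) := rfl
    rw [hΦ, h1, hQJ]
    have := DFunLike.congr_fun hCB (⟨v, hv⟩ : V)
    exact congrArg Subtype.val this

end MinimalRank

end PosSemigroup

namespace PosSemigroup

/-! ### Consequences of a common range of the minimal projections -/

section SharedRange

variable {X : Type*} [NormedAddCommGroup X] [NormedSpace ℝ X] [Lattice X] [IsOrderedAddMonoid X]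
  [IsOrderedModule ℝ X]

/-- A disjoint positive basis of `Y`. -/
structure IsDisjointBasis (Y : Submodule ℝ X) {r : ℕ} (x : Fin r → X) : Prop where
  pos : ∀ i, 0 < x i
  disjoint : ∀ i j, i ≠ j → x i ⊓ x j = 0
  linearIndependent : LinearIndependent ℝ x
  span_eq : Submodule.span ℝ (Set.range x) = Y

theorem IsPermutedBasis.isDisjointBasis {𝒮 : Subsemigroup (X →L[ℝ] X)} {Y : Submodule ℝ X} {r : ℕ}
    {x : Fin r → X} (hx : IsPermutedBasis 𝒮 Y x) : IsDisjointBasis Y x :=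
  ⟨hx.pos, hx.disjoint, hx.linearIndependent, hx.span_eq⟩

theorem IsDisjointBasis.mem {Y : Submodule ℝ X} {r : ℕ} {x : Fin r → X}
    (hx : IsDisjointBasis Y x) (i : Fin r) : x i ∈ Y :=
  hx.span_eq ▸ Submodule.subset_span ⟨i, rfl⟩

theorem IsDisjointBasis.ne_zero {Y : Submodule ℝ X} {r : ℕ} {x : Fin r → X}
    (hx : IsDisjointBasis Y x) (i : Fin r) : x i ≠ 0 := (hx.pos i).ne'

theorem IsDisjointBasis.exists_coord {Y : Submodule ℝ X} {r : ℕ} {x : Fin r → X}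
    (hx : IsDisjointBasis Y x) {P : X →L[ℝ] X} (hP : IsPositiveOp P) (hPY : ∀ z, P z ∈ Y)
    (hfix : ∀ y ∈ Y, P y = y) :
    ∃ f : Fin r → StrongDual ℝ X, (∀ i, ∀ z : X, 0 ≤ z → 0 ≤ f i z) ∧
      (∀ i j, f i (x j) = if i = j then 1 else 0) ∧ ∀ z : X, P z = ∑ i, f i z • x i := by
  have hspan := hx.span_eq
  subst hspan
  set Y := Submodule.span ℝ (Set.range x) with hY
  let b : Module.Basis (Fin r) ℝ Y := Module.Basis.span hx.linearIndependent
  have hb : ∀ i, (b i : X) = x i := fun i =>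
    congrArg Subtype.val (Module.Basis.span_apply hx.linearIndependent i)
  have : FiniteDimensional ℝ Y := b.finiteDimensional_of_finite
  let f : Fin r → StrongDual ℝ X := fun i =>
    (LinearMap.toContinuousLinearMap (b.coord i)).comp (P.codRestrict Y hPY)
  have hf : ∀ i z, f i z = b.repr ⟨P z, hPY z⟩ i := fun i z => rfl
  have hPsum : ∀ z, P z = ∑ i, f i z • x i := fun z => by
    have := congrArg Subtype.val (b.sum_repr ⟨P z, hPY z⟩)
    rw [Submodule.coe_sum] at this
    refine this.symm.trans ?_
    simp [hf, hb]
  refine ⟨f, fun i z hz => ?_, fun i j => ?_, hPsum⟩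
  · have h := hP z hz
    rw [hPsum] at h
    exact nonneg_coord_of_disjoint (fun i _ => hx.pos i) (fun i _ j _ => hx.disjoint i j) h
      (Finset.mem_univ i)
  · have : (⟨P (x j), hPY (x j)⟩ : Y) = b j := 
      Subtype.ext ((hfix _ (hx.mem j)).trans (hb j).symm)
    rw [hf, this, b.repr_self, Finsupp.single_apply]
    simp only [eq_comm]

/-- The standing assumptions: a closed ideal irreducible semigroup of positive operators with
minimal rank `r`, all of whose projections of rank `r` have the range `Y`. -/
structure HasSharedRange (𝒮 : Subsemigroup (X →L[ℝ] X)) (r : ℕ) (Y : Submodule ℝ X) : Prop where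
  pos : ∀ S ∈ 𝒮, IsPositiveOp S
  closed : IsRPlusClosed 𝒮
  irreducible : IsIdealIrreducible 𝒮
  minRank_eq : minRank 𝒮 = r
  range_eq : ∀ P ∈ rankProjections 𝒮 r, LinearMap.range (P : X →ₗ[ℝ] X) = Y

variable {𝒮 : Subsemigroup (X →L[ℝ] X)} {r : ℕ} {Y : Submodule ℝ X}

/-- By minimality the range of `A * T` is all of the range of `A`. Since `T` maps into that range,
`A` maps it onto itself, and finite dimension turns onto into injective. -/
theorem injective_on_range_of_mul_ne_zero (hr : minRank 𝒮 = r) {A T : X →L[ℝ] X} (hA : A ∈ 𝒮)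
    (hT : T ∈ 𝒮) (hAr : opRank A ≤ r)
    (hTA : LinearMap.range (T : X →ₗ[ℝ] X) ≤ LinearMap.range (A : X →ₗ[ℝ] X)) (h0 : A * T ≠ 0) :
    ∀ v ∈ LinearMap.range (A : X →ₗ[ℝ] X), A v = 0 → v = 0 := by
  have hA0 : A ≠ 0 := fun h => h0 (by rw [h, zero_mul])
  have := finiteDimensional_range_of_opRank_le hAr
  have hfr := finrank_range_of_opRank_eq
    (le_antisymm hAr (le_opRank_of_minRank_eq hr hA hA0))
  have hrange := range_eq_of_le_of_minRank_eq hr (𝒮.mul_mem hA hT) h0 hfr.le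
    (by rintro _ ⟨x, rfl⟩; exact ⟨T x, rfl⟩)
  let B : Module.End ℝ (LinearMap.range (A : X →ₗ[ℝ] X)) :=
    (A : X →ₗ[ℝ] X).restrict fun v _ => ⟨v, rfl⟩
  have hsurj : Function.Surjective B := by
    rintro ⟨v, hv⟩
    rw [← hrange] at hv
    obtain ⟨x, rfl⟩ := hv
    exact ⟨⟨T x, hTA ⟨x, rfl⟩⟩, rfl⟩
  have hinj := LinearMap.injective_iff_surjective.2 hsurj
  intro v hv hAv
  have : (⟨v, hv⟩ : LinearMap.range (A : X →ₗ[ℝ] X)) = 0 :=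
    hinj (by rw [map_zero]; exact Subtype.ext hAv)
  exact congrArg Subtype.val this

theorem exists_nonneg_apply_ne_zero {S : X →L[ℝ] X} (hS : IsPositiveOp S) (h0 : S ≠ 0) :
    ∃ x, 0 ≤ x ∧ S x ≠ 0 := by
  by_contra! h
  exact h0 (ContinuousLinearMap.ext fun x => apply_eq_zero_of_apply_abs hS (h _ (abs_nonneg x)))

namespace HasSharedRange

theorem exists_ne_zero (h : HasSharedRange 𝒮 r Y) : ∃ S ∈ 𝒮, S ≠ 0 :=
  let ⟨S, hS, hS0, _⟩ := exists_opRank_eq_minRank h.minRank_eq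
  ⟨S, hS, hS0⟩

theorem fix (h : HasSharedRange 𝒮 r Y) {P : X →L[ℝ] X} (hP : P ∈ rankProjections 𝒮 r) {y : X}
    (hy : y ∈ Y) : P y = y := by
  rw [← h.range_eq P hP] at hy
  obtain ⟨x, rfl⟩ := hy
  exact DFunLike.congr_fun hP.2.1 x

theorem proj_mem (h : HasSharedRange 𝒮 r Y) {P : X →L[ℝ] X} (hP : P ∈ rankProjections 𝒮 r)
    (z : X) : P z ∈ Y := by
  rw [← h.range_eq P hP]
  exact ⟨z, rfl⟩

variable [HasSolidNorm X]

/-- `T` itself may be nilpotent. Irreducibility supplies `R` with `T * R * T ≠ 0`, and `T * R` has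
the same range as `T` and is injective there. -/
theorem exists_proj_range_eq (h : HasSharedRange 𝒮 r Y) {T : X →L[ℝ] X} (hT : T ∈ 𝒮) (hT0 : T ≠ 0)
    (hTr : opRank T ≤ r) : ∃ P ∈ rankProjections 𝒮 r,
      LinearMap.range (P : X →ₗ[ℝ] X) = LinearMap.range (T : X →ₗ[ℝ] X) := by
  obtain ⟨x, hx, hTx⟩ := exists_nonneg_apply_ne_zero (h.pos T hT) hT0
  obtain ⟨R, hR, hRT⟩ := exists_apply_ne_zero h.pos h.irreducible h.exists_ne_zero (h.pos T hT) hT0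
    (h.pos T hT x hx) hTx
  have hTRT : T * R * T ≠ 0 := fun h0 => hRT (DFunLike.congr_fun h0 x)
  have hTR0 : T * R ≠ 0 := fun h0 => hTRT (by rw [h0, zero_mul])
  have := finiteDimensional_range_of_opRank_le hTr
  have hfr := finrank_range_of_opRank_eq
    (le_antisymm hTr (le_opRank_of_minRank_eq h.minRank_eq hT hT0))
  have hrange := range_eq_of_le_of_minRank_eq h.minRank_eq (𝒮.mul_mem hT hR) hTR0 hfr.le
    (by rintro _ ⟨x, rfl⟩; exact ⟨R x, rfl⟩)
  have hTRr : opRank (T * R) ≤ r := (opRank_mul_le_left T R).trans hTr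
  obtain ⟨⟨P, hP, hPr, -⟩, -⟩ := exists_projection_and_inverse h.closed h.minRank_eq
    (𝒮.mul_mem hT hR) hTR0 hTRr
    (injective_on_range_of_mul_ne_zero h.minRank_eq (𝒮.mul_mem hT hR) hT hTRr hrange.ge hTRT)
  exact ⟨P, hP, hPr.trans hrange⟩

theorem exists_proj (h : HasSharedRange 𝒮 r Y) : ∃ P, P ∈ rankProjections 𝒮 r := by
  obtain ⟨S, hS, hS0, hSr⟩ := exists_opRank_eq_minRank h.minRank_eq
  obtain ⟨P, hP, -⟩ := h.exists_proj_range_eq hS hS0 hSr.le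
  exact ⟨P, hP⟩

theorem range_eq_of_opRank_le (h : HasSharedRange 𝒮 r Y) {T : X →L[ℝ] X} (hT : T ∈ 𝒮) (hT0 : T ≠ 0)
    (hTr : opRank T ≤ r) : LinearMap.range (T : X →ₗ[ℝ] X) = Y := by
  obtain ⟨P, hP, hPr⟩ := h.exists_proj_range_eq hT hT0 hTr
  rw [← hPr, h.range_eq P hP]

theorem proj_ne_zero (h : HasSharedRange 𝒮 r Y) {P : X →L[ℝ] X}
    (hP : P ∈ rankProjections 𝒮 r) : P ≠ 0 := by
  obtain ⟨S, hS, hS0, hSr⟩ := exists_opRank_eq_minRank h.minRank_eq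
  rintro rfl
  have hY : Y = ⊥ := by
    rw [← h.range_eq 0 hP]
    exact LinearMap.range_zero
  have h1 := h.range_eq_of_opRank_le hS hS0 hSr.le
  rw [hY, LinearMap.range_eq_bot] at h1
  exact hS0 (ContinuousLinearMap.coe_injective h1)

theorem finiteDimensional (h : HasSharedRange 𝒮 r Y) : FiniteDimensional ℝ Y := by
  obtain ⟨P, hP⟩ := h.exists_proj
  rw [← h.range_eq P hP]
  exact finiteDimensional_range_of_opRank_le hP.2.2.le

theorem finrank_eq (h : HasSharedRange 𝒮 r Y) : Module.finrank ℝ Y = r := by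
  obtain ⟨P, hP⟩ := h.exists_proj
  rw [← h.range_eq P hP]
  exact finrank_range_of_opRank_eq hP.2.2

theorem apply_mem (h : HasSharedRange 𝒮 r Y) {S : X →L[ℝ] X} (hS : S ∈ 𝒮) {y : X} (hy : y ∈ Y) :
    S y ∈ Y := by
  obtain ⟨P, hP⟩ := h.exists_proj
  have hSy : S y = (S * P) y := by
    change S y = S (P y)
    rw [h.fix hP hy]
  by_cases h0 : S * P = 0
  · rw [hSy, h0]
    exact Y.zero_mem
  · rw [hSy, ← h.range_eq_of_opRank_le (𝒮.mul_mem hS hP.1) h0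
      ((opRank_mul_le_right S P).trans hP.2.2.le)]
    exact ⟨y, rfl⟩

/-- If `S` vanished on `Y`, invariance of `Y` would make `S * R * P` vanish for every `R`, against
irreducibility. -/
theorem mul_proj_ne_zero (h : HasSharedRange 𝒮 r Y) {S P : X →L[ℝ] X} (hS : S ∈ 𝒮) (hS0 : S ≠ 0)
    (hP : P ∈ rankProjections 𝒮 r) : S * P ≠ 0 := by
  intro h0
  obtain ⟨x, hx, hPx⟩ := exists_nonneg_apply_ne_zero (h.pos P hP.1) (h.proj_ne_zero hP)
  obtain ⟨R, hR, hRP⟩ := exists_apply_ne_zero h.pos h.irreducible h.exists_ne_zero (h.pos S hS) hS0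
    (h.pos P hP.1 x hx) hPx
  have h1 := DFunLike.congr_fun h0 (R (P x))
  change S (P (R (P x))) = 0 at h1
  rw [h.fix hP (h.apply_mem hR (h.proj_mem hP x))] at h1
  exact hRP h1

/-- `S * P` has minimal rank and range `Y`, and `(S * P) * P = S * P ≠ 0`, so the compactness
argument applies to it. -/
theorem exists_inverse (h : HasSharedRange 𝒮 r Y) {S : X →L[ℝ] X} (hS : S ∈ 𝒮) (hS0 : S ≠ 0) :
    ∃ S' ∈ 𝒮, ∀ y ∈ Y, S' (S y) = y ∧ S (S' y) = y := by
  obtain ⟨P, hP⟩ := h.exists_proj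
  have h0 := h.mul_proj_ne_zero hS hS0 hP
  have hm := 𝒮.mul_mem hS hP.1
  have hrk : opRank (S * P) ≤ r := (opRank_mul_le_right S P).trans hP.2.2.le
  have hrange := h.range_eq_of_opRank_le hm h0 hrk
  obtain ⟨-, S', hS', hinv⟩ := exists_projection_and_inverse h.closed h.minRank_eq hm h0 hrk
    (injective_on_range_of_mul_ne_zero h.minRank_eq hm hP.1 hrk
      (by rw [hrange, h.range_eq P hP]) (by rw [mul_assoc, hP.2.1]; exact h0))
  have hleft : ∀ y ∈ Y, S' (S y) = y := fun y hy => by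
    have h1 := hinv y (hrange ▸ hy)
    change S' (S (P y)) = y at h1
    rwa [h.fix hP hy] at h1
  refine ⟨S', hS', fun y hy => ⟨hleft y hy, ?_⟩⟩
  rw [← hrange] at hy
  obtain ⟨x, rfl⟩ := hy
  change S (S' (S (P x))) = S (P x)
  rw [hleft _ (h.proj_mem hP x)]

theorem eq_zero_of_apply_eq_zero (h : HasSharedRange 𝒮 r Y) {S : X →L[ℝ] X} (hS : S ∈ 𝒮)
    (hS0 : S ≠ 0) {y : X} (hy : y ∈ Y) (hSy : S y = 0) : y = 0 := by
  obtain ⟨S', -, hinv⟩ := h.exists_inverse hS hS0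
  rw [← (hinv y hy).1, hSy, map_zero]

/-- The kernel of `P * R` is that of some projection of minimal rank. -/
theorem exists_proj_ker_eq (h : HasSharedRange 𝒮 r Y) {P R : X →L[ℝ] X}
    (hP : P ∈ rankProjections 𝒮 r) (hR : R ∈ 𝒮) (hR0 : R ≠ 0) :
    ∃ Q ∈ rankProjections 𝒮 r, ∀ z, P (R z) = 0 ↔ Q z = 0 := by
  have hm := 𝒮.mul_mem hP.1 hR
  have hPRP : P * R * P ≠ 0 := by
    have h1 : P * R * P = R * P := by
      ext x
      exact h.fix hP (h.apply_mem hR (h.proj_mem hP x))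
    rw [h1]
    exact h.mul_proj_ne_zero hR hR0 hP
  have h0 : P * R ≠ 0 := fun h0 => hPRP (by rw [h0, zero_mul])
  have hrk : opRank (P * R) ≤ r := (opRank_mul_le_left P R).trans hP.2.2.le
  obtain ⟨⟨Q, hQ, -, hker⟩, -⟩ := exists_projection_and_inverse h.closed h.minRank_eq hm h0 hrk
    (injective_on_range_of_mul_ne_zero h.minRank_eq hm hP.1 hrk
      (by rw [h.range_eq_of_opRank_le hm h0 hrk, h.range_eq P hP]) hPRP)
  exact ⟨Q, hQ, hker⟩

/-- The minimal projections jointly separate positive vectors from 0: irreducibility gives `P (R z)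
≠ 0`, and `P * R` has the kernel of a minimal projection. -/
theorem exists_proj_apply_ne_zero (h : HasSharedRange 𝒮 r Y) {z : X} (hz : 0 ≤ z) (hz0 : z ≠ 0) :
    ∃ Q ∈ rankProjections 𝒮 r, Q z ≠ 0 := by
  obtain ⟨P, hP⟩ := h.exists_proj
  obtain ⟨R, hR, hRz⟩ := exists_apply_ne_zero h.pos h.irreducible h.exists_ne_zero (h.pos P hP.1)
    (h.proj_ne_zero hP) hz hz0
  obtain ⟨Q, hQ, hker⟩ := h.exists_proj_ker_eq hP hR (fun h0 => hRz (by simp [h0]))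
  exact ⟨Q, hQ, fun h0 => hRz ((hker z).2 h0)⟩

/-- The defect `P |y| - |y|` is positive. Any other minimal projection `Q` maps it to `P |y| - Q
|y|`, and `Q |y| = P (Q |y|) ≥ P |y|`. So every `Q` annihilates the defect, which therefore
vanishes. -/
theorem abs_mem (h : HasSharedRange 𝒮 r Y) {y : X} (hy : y ∈ Y) : |y| ∈ Y := by
  obtain ⟨P, hP⟩ := h.exists_proj
  have hle : ∀ Q ∈ rankProjections 𝒮 r, |y| ≤ Q |y| := fun Q hQ => by
    have := (h.pos Q hQ.1).abs_apply_le y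
    rwa [h.fix hQ hy] at this
  by_cases hz0 : P |y| - |y| = 0
  · rw [← sub_eq_zero.1 hz0]
    exact h.proj_mem hP _
  obtain ⟨Q, hQ, hQz⟩ := h.exists_proj_apply_ne_zero (sub_nonneg.2 (hle P hP)) hz0
  refine absurd (le_antisymm ?_ (h.pos Q hQ.1 _ (sub_nonneg.2 (hle P hP)))) hQz
  have h1 := (h.pos P hP.1).mono (hle Q hQ)
  rw [h.fix hP (h.proj_mem hQ _)] at h1
  rw [map_sub, h.fix hQ (h.proj_mem hP _)]
  exact sub_nonpos.2 h1

theorem exists_disjointBasis (h : HasSharedRange 𝒮 r Y) :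
    ∃ x : Fin r → X, IsDisjointBasis Y x := by
  have := h.finiteDimensional
  obtain ⟨s, hs, hspan⟩ := exists_disjointSystem_span_eq (Y := Y) fun y hy => h.abs_mem hy
  have hcard : s.card = r := by
    rw [← h.finrank_eq, ← hspan]
    exact (finrank_span_finset_eq_card (R := ℝ) (s := s) hs.linearIndepOn).symm
  let e : Fin r ≃ s := (Finset.equivFinOfCardEq hcard).symm
  refine ⟨fun i => e i, fun i => hs.pos _ (e i).2, fun i j hij => hs.disjoint _ (e i).2 _ (e j).2
    fun h => hij (e.injective (Subtype.ext h)), ?_, ?_⟩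
  · exact (LinearIndepOn.linearIndependent hs.linearIndepOn).comp e e.injective
  · rw [← hspan]
    congr 1
    ext z
    constructor
    · rintro ⟨i, rfl⟩
      exact (e i).2
    · intro hz
      exact ⟨e.symm ⟨z, hz⟩, by simp⟩

end HasSharedRange

end SharedRange

end PosSemigroup

namespace PosSemigroup

open Filter Topology

/-! ### Monomial actions with positive weights -/

section Monomial

variable {X : Type*} [NormedAddCommGroup X] [NormedSpace ℝ X]

/-- `S` maps each `x i` to a positive multiple `w i` of `x (σ i)`. -/
structure ActsMonomially {r : ℕ} (x : Fin r → X) (S : X →L[ℝ] X) (w : Fin r → ℝ)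
    (σ : Equiv.Perm (Fin r)) : Prop where
  pos : ∀ i, 0 < w i
  apply : ∀ i, S (x i) = w i • x (σ i)

namespace ActsMonomially

variable {r : ℕ} {x : Fin r → X} {S T : X →L[ℝ] X} {w v : Fin r → ℝ} {σ τ : Equiv.Perm (Fin r)}

theorem mul (hS : ActsMonomially x S w σ) (hT : ActsMonomially x T v τ) :
    ActsMonomially x (S * T) (fun i => v i * w (τ i)) (σ * τ) where
  pos i := mul_pos (hT.pos i) (hS.pos _)
  apply i := by
    change S (T (x i)) = _
    rw [hT.apply, map_smul, hS.apply, smul_smul, Equiv.Perm.mul_apply]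

theorem prod_mul (w v : Fin r → ℝ) (τ : Equiv.Perm (Fin r)) :
    ∏ i, v i * w (τ i) = (∏ i, w i) * ∏ i, v i := by
  rw [Finset.prod_mul_distrib, Equiv.prod_comp τ w, mul_comm]

theorem smul (hS : ActsMonomially x S w σ) {t : ℝ} (ht : 0 < t) :
    ActsMonomially x (t • S) (fun i => t * w i) σ where
  pos i := mul_pos ht (hS.pos i)
  apply i := by
    change t • S (x i) = _
    rw [hS.apply, smul_smul]

theorem pow (hS : ActsMonomially x S w σ) (n : ℕ) : ∃ w' : Fin r → ℝ,
    ActsMonomially x (S ^ n) w' (σ ^ n) ∧ ∏ i, w' i = (∏ i, w i) ^ n ∧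
      ∀ i, σ i = i → w' i = w i ^ n := by
  induction n with
  | zero => exact ⟨fun _ => 1, ⟨fun _ => one_pos, fun i => by simp⟩, by simp, by simp⟩
  | succ n ih =>
    obtain ⟨w', h1, h2, h3⟩ := ih
    refine ⟨_, by rw [pow_succ, pow_succ]; exact h1.mul hS, ?_, fun i hi => ?_⟩
    · rw [prod_mul, h2, pow_succ]
    · rw [hi, h3 i hi, pow_succ']

/-- The scalar is the `r`-th root of the inverse of the product of the weights. Unit product is
preserved by composition, which makes it the right normalisation. -/
theorem exists_smul_prod_eq_one (hS : ActsMonomially x S w σ) (hr : r ≠ 0) :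
    ∃ t : ℝ, 0 < t ∧ ActsMonomially x (t • S) (fun i => t * w i) σ ∧ ∏ i, t * w i = 1 := by
  have hW : 0 < ∏ i, w i := Finset.prod_pos fun i _ => hS.pos i
  have ht : 0 < (∏ i, w i)⁻¹ ^ ((r : ℝ)⁻¹) := Real.rpow_pos_of_pos (inv_pos.2 hW) _
  refine ⟨_, ht, hS.smul ht, ?_⟩
  rw [Finset.prod_mul_distrib, Finset.prod_const, Finset.card_univ, Fintype.card_fin,
    Real.rpow_inv_natCast_pow (inv_pos.2 hW).le hr, inv_mul_cancel₀ hW.ne']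

theorem ne_zero (hS : ActsMonomially x S w σ) (hx : ∀ i, x i ≠ 0) (i : Fin r) : S ≠ 0 := by
  rintro rfl
  have := (hS.apply i).symm
  rcases smul_eq_zero.1 this with h | h
  · exact (hS.pos i).ne' h
  · exact hx _ h

end ActsMonomially

end Monomial

/-! ### Removing the weights -/

section PermutedBasis

variable {X : Type*} [NormedAddCommGroup X] [NormedSpace ℝ X] [Lattice X] [IsOrderedAddMonoid X]
  [IsOrderedModule ℝ X]

theorem linearIndependent_of_disjoint {ι : Type*} [Fintype ι] {x : ι → X} (hx : ∀ i, 0 < x i)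
    (hd : ∀ i j, i ≠ j → x i ⊓ x j = 0) : LinearIndependent ℝ x :=
  Fintype.linearIndependent_iff.2 fun _ h i => eq_zero_of_disjoint_of_sum_eq_zero
    (fun i _ => hx i) (fun i _ j _ => hd i j) h (Finset.mem_univ i)

theorem pow_succ_mem {𝒮 : Subsemigroup (X →L[ℝ] X)} {S : X →L[ℝ] X} (hS : S ∈ 𝒮) (n : ℕ) :
    S ^ (n + 1) ∈ 𝒮 := by
  induction n with
  | zero => simpa using hS
  | succ n ih =>
    rw [pow_succ]
    exact 𝒮.mul_mem ih hS

variable [HasSolidNorm X] {𝒮 : Subsemigroup (X →L[ℝ] X)} {r : ℕ} {Y : Submodule ℝ X}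

namespace HasSharedRange

theorem exists_coord (h : HasSharedRange 𝒮 r Y) {x : Fin r → X} (hx : IsDisjointBasis Y x)
    {P : X →L[ℝ] X} (hP : P ∈ rankProjections 𝒮 r) :
    ∃ f : Fin r → StrongDual ℝ X, (∀ i, ∀ z : X, 0 ≤ z → 0 ≤ f i z) ∧
      (∀ i j, f i (x j) = if i = j then 1 else 0) ∧ ∀ z : X, P z = ∑ i, f i z • x i :=
  hx.exists_coord (h.pos P hP.1) (h.proj_mem hP) fun _ => h.fix hP

/-- A positive operator with a positive inverse on `Y` permutes the disjoint basis up to scalars. -/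
theorem exists_actsMonomially (h : HasSharedRange 𝒮 r Y) {x : Fin r → X}
    (hx : IsDisjointBasis Y x) {S : X →L[ℝ] X} (hS : S ∈ 𝒮) (hS0 : S ≠ 0) :
    ∃ w σ, ActsMonomially x S w σ := by
  obtain ⟨P, hP⟩ := h.exists_proj
  obtain ⟨f, hf0, hfx, hfP⟩ := h.exists_coord hx hP
  obtain ⟨S', hS', hinv⟩ := h.exists_inverse hS hS0
  have hcoord : ∀ y ∈ Y, y = ∑ i, f i y • x i := fun y hy => by rw [← hfP, h.fix hP hy]
  have key : ∀ i, ∃ (w : ℝ) (j : Fin r), 0 < w ∧ S (x i) = w • x j := by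
    intro i
    have hSY := h.apply_mem hS (hx.mem i)
    have hSx := h.pos S hS _ (hx.pos i).le
    obtain ⟨j, hj⟩ : ∃ j, f j (S (x i)) ≠ 0 := by
      by_contra! h0
      refine hx.ne_zero i (h.eq_zero_of_apply_eq_zero hS hS0 (hx.mem i) ?_)
      rw [hcoord _ hSY]
      simp [h0]
    have hc : 0 < f j (S (x i)) := (hf0 j _ hSx).lt_of_ne' hj
    have hle : f j (S (x i)) • x j ≤ S (x i) := by
      conv_rhs => rw [hcoord _ hSY]
      exact Finset.single_le_sum (f := fun k => f k (S (x i)) • x k)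
        (fun k _ => smul_nonneg (hf0 k _ hSx) (hx.pos k).le) (Finset.mem_univ j)
    have hle' := (h.pos S' hS').mono hle
    rw [map_smul, (hinv _ (hx.mem i)).1] at hle'
    have hS'x := h.pos S' hS' _ (hx.pos j).le
    have hzero : ∀ k, k ≠ i → f k (S' (x j)) = 0 := by
      intro k hk
      have h1 := apply_le_apply_of_nonneg (hf0 k) hle'
      rw [map_smul, hfx, if_neg hk, smul_eq_mul] at h1
      exact le_antisymm (nonpos_of_mul_nonpos_right h1 hc) (hf0 k _ hS'x)
    have hS'e : S' (x j) = f i (S' (x j)) • x i := by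
      conv_lhs => rw [hcoord _ (h.apply_mem hS' (hx.mem j))]
      exact Finset.sum_eq_single i (fun k _ hk => by rw [hzero k hk, zero_smul])
        (fun hi => absurd (Finset.mem_univ i) hi)
    have hxj : x j = f i (S' (x j)) • S (x i) := by
      rw [← map_smul, ← hS'e, (hinv _ (hx.mem j)).2]
    have hs : 0 < f i (S' (x j)) := (hf0 i _ hS'x).lt_of_ne' fun h0 =>
      hx.ne_zero j (by rw [hxj, h0, zero_smul])
    refine ⟨(f i (S' (x j)))⁻¹, j, inv_pos.2 hs, ?_⟩
    rw [eq_inv_smul_iff₀ hs.ne']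
    exact hxj.symm
  choose w j hw hSx using key
  have hinj : Function.Injective j := by
    intro i k hik
    by_contra hne
    have h1 : w k • x i - w i • x k = 0 := by
      refine h.eq_zero_of_apply_eq_zero hS hS0
        (Y.sub_mem (Y.smul_mem _ (hx.mem i)) (Y.smul_mem _ (hx.mem k))) ?_
      rw [map_sub, map_smul, map_smul, hSx, hSx, hik, smul_comm, sub_self]
    have h2 := congrArg (f i) h1
    rw [map_sub, map_smul, map_smul, hfx, hfx, if_pos rfl, if_neg hne, map_zero] at h2
    simp only [smul_eq_mul, mul_one, mul_zero, sub_zero] at h2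
    exact (hw k).ne' h2
  exact ⟨w, Equiv.ofBijective j (Finite.injective_iff_bijective.1 hinj), hw, hSx⟩

/-- An operator of the semigroup which is diagonal in a disjoint basis is scalar on `Y`. -/
theorem weights_eq_of_diagonal (h : HasSharedRange 𝒮 r Y) {x : Fin r → X}
    (hx : IsDisjointBasis Y x) {S : X →L[ℝ] X} (hS : S ∈ 𝒮) {w : Fin r → ℝ}
    (hw : ActsMonomially x S w 1) (i j : Fin r) : w i = w j := by
  obtain ⟨P, hP⟩ := h.exists_proj
  obtain ⟨f, hf0, hfx, hfP⟩ := h.exists_coord hx hP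
  have : Nonempty (Fin r) := ⟨i⟩
  obtain ⟨m, hm⟩ := Finite.exists_max w
  have hM := hw.pos m
  suffices hall : ∀ k, w k = w m by rw [hall i, hall j]
  let D : (Fin r → ℝ) → (X →L[ℝ] X) := fun a => ∑ k, a k • (f k).smulRight (x k)
  have hDapp : ∀ a z, D a z = ∑ k, (a k * f k z) • x k := fun a z => by
    simp [D, mul_smul]
  have hDx : ∀ a k, D a (x k) = a k • x k := fun a k => by
    rw [hDapp]
    simp [hfx]
  have hDmem : ∀ n : ℕ, D (fun k => (w k / w m) ^ n) ∈ 𝒮 := by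
    intro n
    induction n with
    | zero =>
      have : D (fun k => (w k / w m) ^ 0) = P := by
        ext z
        rw [hDapp, hfP]
        simp
      rw [this]
      exact hP.1
    | succ n ih =>
      have : D (fun k => (w k / w m) ^ (n + 1)) = (w m)⁻¹ • (S * D (fun k => (w k / w m) ^ n)) := by
        ext z
        change _ = (w m)⁻¹ • S (D (fun k => (w k / w m) ^ n) z)
        rw [hDapp, hDapp, map_sum, Finset.smul_sum]
        refine Finset.sum_congr rfl fun k _ => ?_
        rw [map_smul, hw.apply, smul_smul, smul_smul, Equiv.Perm.one_apply]
        congr 1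
        ring
      rw [this]
      exact h.closed.2 _ (𝒮.mul_mem hS ih) _ (inv_pos.2 hM)
  -- Dividing by the largest weight keeps the powers bounded. The limit annihilates each `x k` of
  -- smaller weight, but a nonzero member of the semigroup is injective on `Y`.
  have hlim : Tendsto (fun n : ℕ => D (fun k => (w k / w m) ^ n)) atTop
      (𝓝 (D fun k => if w k = w m then 1 else 0)) := by
    refine tendsto_finsetSum _ fun k _ => Tendsto.smul_const ?_ _
    dsimp only
    split_ifs with hk
    · simp [hk, hM.ne']
    · exact tendsto_pow_atTop_nhds_zero_of_lt_one (div_nonneg (hw.pos k).le hM.le)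
        ((div_lt_one hM).2 ((hm k).lt_of_ne hk))
  have hmem : D (fun k => if w k = w m then 1 else 0) ∈ 𝒮 :=
    h.closed.1.mem_of_tendsto hlim (Eventually.of_forall hDmem)
  have hne : D (fun k => if w k = w m then 1 else 0) ≠ 0 := fun h0 => by
    have := hDx (fun k => if w k = w m then 1 else 0) m
    rw [h0, if_pos rfl, one_smul] at this
    exact hx.ne_zero m this.symm
  intro k
  by_contra hk
  refine hx.ne_zero k (h.eq_zero_of_apply_eq_zero hmem hne (hx.mem k) ?_)
  rw [hDx, if_neg hk, zero_smul]

/-- The power of `S` by the order of `σ` is diagonal, hence scalar on `Y`. Its weights have product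
1, so the scalar is 1, and at a fixed point it is a power of `w i`. -/
theorem weight_eq_one_of_fixed (h : HasSharedRange 𝒮 r Y) {x : Fin r → X}
    (hx : IsDisjointBasis Y x) {S : X →L[ℝ] X} (hS : S ∈ 𝒮) {w : Fin r → ℝ}
    {σ : Equiv.Perm (Fin r)} (hw : ActsMonomially x S w σ) (hprod : ∏ k, w k = 1) {i : Fin r}
    (hi : σ i = i) : w i = 1 := by
  obtain ⟨n, hn⟩ := Nat.exists_eq_succ_of_ne_zero (orderOf_pos σ).ne'
  obtain ⟨w', hw', hprod', hfix⟩ := hw.pow (orderOf σ)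
  rw [pow_orderOf_eq_one] at hw'
  have hmem : S ^ orderOf σ ∈ 𝒮 := by
    rw [hn]
    exact pow_succ_mem hS n
  have hconst : ∀ k, w' k = w' i := fun k => h.weights_eq_of_diagonal hx hmem hw' k i
  rw [hprod, one_pow, Finset.prod_congr rfl fun k _ => hconst k, Finset.prod_const,
    Finset.card_univ, Fintype.card_fin] at hprod'
  have hr : r ≠ 0 := fun h0 => by subst h0; exact i.elim0
  rw [pow_eq_one_iff_of_nonneg (hw'.pos i).le hr, hfix i hi,
    pow_eq_one_iff_of_nonneg (hw.pos i).le (orderOf_pos σ).ne'] at hprod'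
  exact hprod'

/-- The semigroup acts transitively on the lines spanned by a disjoint basis. -/
theorem exists_maps_to (h : HasSharedRange 𝒮 r Y) {x : Fin r → X} (hx : IsDisjointBasis Y x)
    (i j : Fin r) : ∃ R ∈ 𝒮, ∃ w σ, ActsMonomially x R w σ ∧ ∏ k, w k = 1 ∧ σ i = j := by
  obtain ⟨P, hP⟩ := h.exists_proj
  obtain ⟨f, hf0, hfx, hfP⟩ := h.exists_coord hx hP
  have hfj : f j ≠ 0 := fun h0 => by
    have := hfx j j
    simp [h0] at this
  obtain ⟨R, hR, hRx⟩ := exists_apply_ne_zero h.pos h.irreducible h.exists_ne_zero (hf0 j) hfj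
    (hx.pos i).le (hx.ne_zero i)
  have hR0 : R ≠ 0 := fun h0 => hRx (by simp [h0])
  obtain ⟨w, σ, hw⟩ := h.exists_actsMonomially hx hR hR0
  have hr : r ≠ 0 := fun h0 => by subst h0; exact i.elim0
  obtain ⟨t, ht, htw, hprod⟩ := hw.exists_smul_prod_eq_one hr
  refine ⟨t • R, h.closed.2 R hR t ht, _, σ, htw, hprod, ?_⟩
  by_contra hne
  exact hRx (by rw [hw.apply, map_smul, hfx, if_neg (Ne.symm hne), smul_zero])

theorem exists_isPermutedBasis (h : HasSharedRange 𝒮 r Y) :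
    ∃ x : Fin r → X, IsPermutedBasis 𝒮 Y x := by
  obtain ⟨x, hx⟩ := h.exists_disjointBasis
  by_cases hr : r = 0
  · subst hr
    exact ⟨x, hx.pos, hx.disjoint, hx.linearIndependent, hx.span_eq, fun S _ =>
      ⟨0, 1, fun i => i.elim0⟩⟩
  let o : Fin r := ⟨0, Nat.pos_of_ne_zero hr⟩
  -- The new basis consists of the images `R i (x o)` of one vector under operators of weight
  -- product 1.
  choose R hR w σ hw hprod hσ using fun i => h.exists_maps_to hx o i
  have hRx : ∀ i, R i (x o) = w i o • x i := fun i => by rw [(hw i).apply, hσ]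
  have hpos : ∀ i, 0 < w i o • x i := fun i =>
    (smul_nonneg ((hw i).pos o).le (hx.pos i).le).lt_of_ne' (smul_ne_zero ((hw i).pos o).ne'
      (hx.ne_zero i))
  have hdisj : ∀ i j, i ≠ j → (w i o • x i) ⊓ (w j o • x j) = 0 := fun i j hij => by
    refine inf_smul_eq_zero ((hw j).pos o).le ?_
    rw [inf_comm]
    refine inf_smul_eq_zero ((hw i).pos o).le ?_
    rw [inf_comm]
    exact hx.disjoint i j hij
  refine ⟨fun i => w i o • x i, hpos, hdisj, linearIndependent_of_disjoint hpos hdisj,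
    le_antisymm ?_ ?_, fun S hS => ?_⟩
  · rw [Submodule.span_le]
    rintro _ ⟨i, rfl⟩
    exact Y.smul_mem _ (hx.mem i)
  · rw [← hx.span_eq, Submodule.span_le]
    rintro _ ⟨i, rfl⟩
    have : x i = (w i o)⁻¹ • (w i o • x i) := (inv_smul_smul₀ ((hw i).pos o).ne' _).symm
    rw [this]
    exact Submodule.smul_mem _ _ (Submodule.subset_span ⟨i, rfl⟩)
  by_cases hS0 : S = 0
  · exact ⟨0, 1, fun i => by simp [hS0]⟩
  obtain ⟨u, τ, hu⟩ := h.exists_actsMonomially hx hS hS0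
  obtain ⟨t, ht, htu, htprod⟩ := hu.exists_smul_prod_eq_one hr
  have htS := h.closed.2 S hS t ht
  refine ⟨t⁻¹, τ, fun i => ?_⟩
  -- `Q` returns line `τ i` to line `o`. Both `Q * R (τ i)` and `Q * (t • S * R i)` have weight
  -- product 1 and preserve line `o`, so both fix `x o`; injectivity of `Q` on `Y` identifies the
  -- two images before `Q`.
  obtain ⟨Q, hQ, v, ρ, hv, hvprod, hρ⟩ := h.exists_maps_to hx (τ i) o
  have h1 : (Q * R (τ i)) (x o) = x o := by
    have hm := hv.mul (hw (τ i))
    have hfix : (ρ * σ (τ i)) o = o := by rw [Equiv.Perm.mul_apply, hσ, hρ]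
    rw [hm.apply, hfix, h.weight_eq_one_of_fixed hx (𝒮.mul_mem hQ (hR _)) hm
      (by rw [ActsMonomially.prod_mul, hvprod, hprod, one_mul]) hfix, one_smul]
  have h2 : (Q * (t • S * R i)) (x o) = x o := by
    have hm := hv.mul (htu.mul (hw i))
    have hfix : (ρ * (τ * σ i)) o = o := by
      rw [Equiv.Perm.mul_apply, Equiv.Perm.mul_apply, hσ, hρ]
    rw [hm.apply, hfix, h.weight_eq_one_of_fixed hx (𝒮.mul_mem hQ (𝒮.mul_mem htS (hR _))) hm
      (by rw [ActsMonomially.prod_mul,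
        ActsMonomially.prod_mul (fun k => t * u k) (w i) (σ i), hvprod, hprod, htprod, one_mul,
        one_mul]) hfix, one_smul]
  have h3 : Q (t • S (R i (x o)) - R (τ i) (x o)) = 0 := by
    rw [map_sub, sub_eq_zero]
    exact h2.trans h1.symm
  have h4 := h.eq_zero_of_apply_eq_zero hQ (hv.ne_zero hx.ne_zero o)
    (Y.sub_mem (Y.smul_mem _ (h.apply_mem hS (h.apply_mem (hR i) (hx.mem o))))
      (h.apply_mem (hR _) (hx.mem o))) h3
  rw [sub_eq_zero, hRx, hRx] at h4
  rw [eq_inv_smul_iff₀ ht.ne']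
  exact h4

end HasSharedRange

end PermutedBasis

end PosSemigroup

namespace PosSemigroup

open scoped TensorProduct

/-! ### Spectral radius of a scaled permutation -/

section SpectralRadius

variable {V : Type*} [AddCommGroup V] [Module ℝ V]

/-- The spectral radius of an operator, some power of which is the scalar `c ^ m`, and which has
`c` as an eigenvalue. -/
theorem realSpectralRadius_eq_of_pow_eq {T : Module.End ℝ V} {c : ℝ} (hc : 0 ≤ c) {m : ℕ}
    (hm : m ≠ 0) (hT : T ^ m = (c ^ m) • (1 : Module.End ℝ V)) {v : V} (hv : v ≠ 0)
    (hTv : T v = c • v) : realSpectralRadius T = c := by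
  set A : Module.End ℂ (ℂ ⊗[ℝ] V) := LinearMap.baseChange ℂ T with hA
  have hv' : (1 : ℂ) ⊗ₜ[ℝ] v ≠ 0 := fun h0 =>
    hv ((Module.FaithfullyFlat.one_tmul_eq_zero_iff ℝ V v).1 h0)
  have : Nontrivial (ℂ ⊗[ℝ] V) := nontrivial_of_ne _ _ hv'
  have hAv : A ((1 : ℂ) ⊗ₜ[ℝ] v) = (c : ℂ) • ((1 : ℂ) ⊗ₜ[ℝ] v) := by
    rw [hA, LinearMap.baseChange_tmul, hTv, TensorProduct.tmul_smul]
    simp [TensorProduct.smul_tmul']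
  have hmem : (c : ℂ) ∈ spectrum ℂ A :=
    (Module.End.hasEigenvalue_of_hasEigenvector
      (Module.End.hasEigenvector_iff.2 ⟨Module.End.mem_eigenspace_iff.2 hAv, hv'⟩)).mem_spectrum
  have hApow : A ^ m = algebraMap ℂ (Module.End ℂ (ℂ ⊗[ℝ] V)) ((c : ℂ) ^ m) := by
    have h1 : A ^ m = LinearMap.baseChange ℂ (T ^ m) :=
      (map_pow (Module.End.baseChangeHom ℝ ℂ V) T m).symm
    rw [h1, hT, LinearMap.baseChange_smul, Algebra.algebraMap_eq_smul_one]
    ext w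
    simp [TensorProduct.smul_tmul']
  have hnorm : ∀ k ∈ spectrum ℂ A, ‖k‖ = c := by
    intro k hk
    have h1 := spectrum.pow_mem_pow A m hk
    rw [hApow, spectrum.scalar_eq, Set.mem_singleton_iff] at h1
    have h2 := congrArg norm h1
    rw [norm_pow, norm_pow, Complex.norm_real, Real.norm_of_nonneg hc] at h2
    exact (pow_left_inj₀ (norm_nonneg _) hc hm).1 h2
  have hnn : ∀ k ∈ spectrum ℂ A, (‖k‖₊ : ENNReal) = ENNReal.ofReal c := fun k hk => by
    rw [← hnorm k hk, ofReal_norm]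
    rfl
  have hrad : spectralRadius ℂ A = ENNReal.ofReal c :=
    le_antisymm (iSup₂_le fun k hk => (hnn k hk).le)
      (le_iSup₂_of_le (c : ℂ) hmem (hnn _ hmem).ge)
  rw [realSpectralRadius, hrad, ENNReal.toReal_ofReal hc]

end SpectralRadius

/-! ### Coefficients of common eigenvectors -/

section EigenCoefficients

/-- Coefficient vectors which are permuted, up to scalars, by a transitive family. -/
theorem eigenCoefficients {κ : Type*} {r : ℕ} {nz : κ → Prop} {ρ lam : κ → ℝ}
    {σ : κ → Equiv.Perm (Fin r)} (hρ0 : ∀ s, 0 ≤ ρ s) (hρ : ∀ s, nz s → 0 < ρ s)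
    (htrans : ∀ i j, ∃ s, nz s ∧ σ s i = j) {a : Fin r → ℝ} (ha : a ≠ 0)
    (heq : ∀ s i, ρ s * a i = lam s * a (σ s i)) :
    (∀ s, |lam s| = ρ s) ∧ (∃ c, ∀ i, |a i| = c) ∧
      (((∀ i, 0 ≤ a i) ∨ ∀ s, nz s → 0 < lam s) → ∃ c, ∀ i, a i = c) := by
  obtain ⟨o, ho⟩ := Function.ne_iff.1 ha
  have habs : ∀ s i, ρ s * |a i| = |lam s| * |a (σ s i)| := fun s i => by
    rw [← abs_mul, ← heq, abs_mul, abs_of_nonneg (hρ0 s)]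
  have hlam : ∀ s, |lam s| = ρ s := fun s => by
    -- A permutation does not change the sum of the moduli, which is positive because `a ≠ 0`.
    have h1 : ρ s * ∑ i, |a i| = |lam s| * ∑ i, |a i| := by
      conv_rhs => rw [← Equiv.sum_comp (σ s) fun i => |a i|]
      rw [Finset.mul_sum, Finset.mul_sum]
      exact Finset.sum_congr rfl fun i _ => habs s i
    have h2 : 0 < ∑ i, |a i| :=
      Finset.sum_pos' (fun i _ => abs_nonneg _) ⟨o, Finset.mem_univ o, abs_pos.2 ho⟩
    exact (mul_right_cancel₀ h2.ne' h1).symm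
  have habs' : ∀ i, |a i| = |a o| := fun i => by
    obtain ⟨s, hs, hi⟩ := htrans o i
    have h1 := habs s o
    rw [hlam, hi] at h1
    exact (mul_left_cancel₀ (hρ s hs).ne' h1).symm
  refine ⟨hlam, ⟨_, habs'⟩, fun h => ⟨a o, fun i => ?_⟩⟩
  rcases h with h | h
  · rw [← abs_of_nonneg (h i), ← abs_of_nonneg (h o), habs']
  · obtain ⟨s, hs, hi⟩ := htrans o i
    have h1 := heq s o
    rw [hi, ← hlam s, abs_of_pos (h s hs)] at h1
    exact (mul_left_cancel₀ (h s hs).ne' h1).symm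

end EigenCoefficients

/-! ### Quasi-interior eigenvectors -/

section QuasiInterior

variable {X : Type*} [NormedAddCommGroup X] [NormedSpace ℝ X] [Lattice X] [IsOrderedAddMonoid X]
  [IsOrderedModule ℝ X]

/-- The order ideal generated by a positive vector `u`. -/
def principalIdeal (u : X) : Submodule ℝ X where
  carrier := {x | ∃ c : ℝ, |x| ≤ c • u}
  zero_mem' := ⟨0, by simp⟩
  add_mem' := by
    rintro a b ⟨c, hc⟩ ⟨d, hd⟩
    exact ⟨c + d, (abs_add_le a b).trans (by rw [add_smul]; exact add_le_add hc hd)⟩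
  smul_mem' := by
    rintro t a ⟨c, hc⟩
    refine ⟨|t| * c, (abs_smul_le_smul_abs t a).trans ?_⟩
    rw [mul_smul]
    exact smul_le_smul_of_nonneg_left hc (abs_nonneg t)

theorem isOrderIdeal_principalIdeal (u : X) : IsOrderIdeal (principalIdeal u) :=
  fun _ ⟨c, hc⟩ _ hyx => ⟨c, hyx.trans hc⟩

variable [HasSolidNorm X]

theorem IsOrderIdeal.topologicalClosure {J : Submodule ℝ X} (hJ : IsOrderIdeal J) :
    IsOrderIdeal J.topologicalClosure := by
  intro b hb a hab
  -- Truncating `a` to the interval `[-|y|, |y|]` is continuous in `y`, lands in `J` for `y ∈ J`,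
  -- and returns `a` at `y = b`.
  let φ : X → X := fun y => (a ⊓ |y|) ⊔ (-|y|)
  have hφ : Continuous φ :=
    (continuous_const.inf (continuous_id.sup continuous_neg)).sup
      (continuous_id.sup continuous_neg).neg
  have hφb : φ b = a := by
    have h1 : a ⊓ |b| = a := inf_eq_left.2 ((le_abs_self a).trans hab)
    have h2 : -|b| ≤ a := neg_le.1 ((neg_le_abs a).trans hab)
    change (a ⊓ |b|) ⊔ (-|b|) = a
    rw [h1, sup_eq_left.2 h2]
  rw [← hφb]
  refine map_mem_closure hφ hb fun y hy => hJ hy ?_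
  refine abs_le'.2 ⟨sup_le inf_le_right ((neg_nonpos.2 (abs_nonneg y)).trans (abs_nonneg y)), ?_⟩
  exact neg_le.1 le_sup_right

/-- The ideal generated by a positive common eigenvector is invariant, so its closure is a nonzero
closed invariant ideal. -/
theorem isQuasiInterior_of_apply_le {𝒮 : Subsemigroup (X →L[ℝ] X)}
    (hpos : ∀ S ∈ 𝒮, IsPositiveOp S) (hirr : IsIdealIrreducible 𝒮) {u : X} (hu : 0 < u)
    (hSu : ∀ S ∈ 𝒮, ∃ d : ℝ, S u = d • u) : IsQuasiInterior u := by
  set J := principalIdeal u with hJ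
  have huJ : u ∈ J := ⟨1, by rw [abs_of_nonneg hu.le, one_smul]⟩
  have hinv : ∀ S ∈ 𝒮, ∀ x ∈ J, S x ∈ J := by
    rintro S hS x ⟨c, hc⟩
    obtain ⟨d, hd⟩ := hSu S hS
    refine ⟨c * d, ((hpos S hS).abs_apply_le x).trans (((hpos S hS).mono hc).trans ?_)⟩
    rw [map_smul, hd, mul_smul]
  refine ⟨hu.le, ?_⟩
  rcases hirr J.topologicalClosure (isOrderIdeal_principalIdeal u).topologicalClosure
    J.isClosed_topologicalClosure
    (fun S hS x hx => map_mem_closure S.continuous hx fun y hy => hinv S hS y hy) with h | h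
  · have := J.le_topologicalClosure huJ
    rw [h, Submodule.mem_bot] at this
    exact absurd this hu.ne'
  · exact (Submodule.dense_iff_topologicalClosure_eq_top (s := J)).2 h

end QuasiInterior

end PosSemigroup

namespace PosSemigroup

/-! ### Eigenvectors, eigenfunctionals and the theorem -/

section Main

variable {X : Type*} [NormedAddCommGroup X] [NormedSpace ℝ X] [Lattice X] [IsOrderedAddMonoid X]
  [IsOrderedModule ℝ X] [HasSolidNorm X] {𝒮 : Subsemigroup (X →L[ℝ] X)} {r : ℕ}
  {Y : Submodule ℝ X}

namespace HasSharedRange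

theorem rank_pos (h : HasSharedRange 𝒮 r Y) : 0 < r := by
  obtain ⟨P, hP⟩ := h.exists_proj
  refine Nat.pos_of_ne_zero fun h0 => h.proj_ne_zero hP ?_
  have := h.finiteDimensional
  have hY : Y = ⊥ := Submodule.finrank_eq_zero.1 (h.finrank_eq.trans h0)
  ext z
  have hz := h.proj_mem hP z
  rw [hY, Submodule.mem_bot] at hz
  exact hz

theorem restrictRadius_eq (h : HasSharedRange 𝒮 r Y) {x : Fin r → X} (hx : IsPermutedBasis 𝒮 Y x)
    {S : X →L[ℝ] X} (hS : S ∈ 𝒮) (hinv : ∀ y ∈ Y, S y ∈ Y) {c : ℝ} {σ : Equiv.Perm (Fin r)}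
    (hSx : ∀ i, S (x i) = c • x (σ i)) : 0 ≤ c ∧ restrictRadius S Y hinv = c := by
  have hxb := hx.isDisjointBasis
  let o : Fin r := ⟨0, h.rank_pos⟩
  have hc : 0 ≤ c := by
    by_contra! hc
    have h1 := h.pos S hS _ (hx.pos o).le
    have h2 : 0 ≤ (-c) • x (σ o) := smul_nonneg (by linarith) (hx.pos (σ o)).le
    rw [hSx] at h1
    rw [neg_smul, neg_nonneg] at h2
    rcases smul_eq_zero.1 (le_antisymm h2 h1) with h3 | h3
    · exact hc.ne h3
    · exact hxb.ne_zero _ h3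
  refine ⟨hc, ?_⟩
  have hsum0 : 0 < ∑ i, x i := Finset.sum_pos (fun i _ => hx.pos i) ⟨o, Finset.mem_univ o⟩
  have hSsum : S (∑ i, x i) = c • ∑ i, x i := by
    rw [map_sum, Finset.smul_sum, ← Equiv.sum_comp σ fun i => c • x i]
    exact Finset.sum_congr rfl fun i _ => hSx i
  have hpow : ∀ (n : ℕ) i, ((S : X →ₗ[ℝ] X) ^ n) (x i) = c ^ n • x ((σ ^ n) i) := by
    intro n
    induction n with
    | zero => simp
    | succ n ih =>
      intro i
      rw [pow_succ, Module.End.mul_apply, ContinuousLinearMap.coe_coe, hSx, map_smul, ih, smul_smul,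
        ← pow_succ', pow_succ σ, Equiv.Perm.mul_apply]
  have hscalar : ∀ y ∈ Y, ((S : X →ₗ[ℝ] X) ^ orderOf σ) y = c ^ orderOf σ • y := by
    intro y hy
    rw [← hx.span_eq] at hy
    refine LinearMap.eqOn_span (f := (S : X →ₗ[ℝ] X) ^ orderOf σ)
      (g := c ^ orderOf σ • LinearMap.id) ?_ hy
    rintro _ ⟨i, rfl⟩
    rw [hpow, pow_orderOf_eq_one]
    rfl
  refine realSpectralRadius_eq_of_pow_eq hc (orderOf_pos σ).ne' ?_
    (v := (⟨∑ i, x i, Submodule.sum_mem _ fun i _ => hxb.mem i⟩ : Y))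
    (fun h0 => hsum0.ne' (congrArg Subtype.val h0)) (Subtype.ext hSsum)
  rw [Module.End.pow_restrict (orderOf σ)]
  ext y
  exact hscalar y y.2

/-- Each operator of the semigroup acts on a permuted basis as its radius times a permutation. -/
theorem exists_perm (h : HasSharedRange 𝒮 r Y) {x : Fin r → X} (hx : IsPermutedBasis 𝒮 Y x)
    (hinv : ∀ S : 𝒮, ∀ y ∈ Y, (S : X →L[ℝ] X) y ∈ Y) :
    ∃ σ : 𝒮 → Equiv.Perm (Fin r),
      (∀ (S : 𝒮) i, (S : X →L[ℝ] X) (x i) = restrictRadius S Y (hinv S) • x (σ S i)) ∧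
      (∀ S : 𝒮, 0 ≤ restrictRadius (S : X →L[ℝ] X) Y (hinv S)) ∧
      (∀ S : 𝒮, (S : X →L[ℝ] X) ≠ 0 → 0 < restrictRadius (S : X →L[ℝ] X) Y (hinv S)) ∧
      ∀ i j, ∃ S : 𝒮, (S : X →L[ℝ] X) ≠ 0 ∧ σ S i = j := by
  have hxb := hx.isDisjointBasis
  choose c σ hσ using fun S : 𝒮 => hx.permutes S S.2
  have hrad := fun S : 𝒮 => h.restrictRadius_eq hx S.2 (hinv S) (hσ S)
  have happ : ∀ (S : 𝒮) i, (S : X →L[ℝ] X) (x i) = restrictRadius S Y (hinv S) • x (σ S i) :=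
    fun S i => by rw [(hrad S).2, hσ]
  refine ⟨σ, happ, fun S => (hrad S).2 ▸ (hrad S).1, fun S hS => ?_, fun i j => ?_⟩
  · rw [(hrad S).2]
    refine (hrad S).1.lt_of_ne' fun h0 => ?_
    let o : Fin r := ⟨0, h.rank_pos⟩
    exact hxb.ne_zero o (h.eq_zero_of_apply_eq_zero S.2 hS (hxb.mem o) (by rw [hσ, h0, zero_smul]))
  · obtain ⟨R, hR, w, τ, hw, -, hτ⟩ := h.exists_maps_to hxb i j
    refine ⟨⟨R, hR⟩, hw.ne_zero hxb.ne_zero i, ?_⟩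
    obtain ⟨P, hP⟩ := h.exists_proj
    obtain ⟨f, -, hfx, -⟩ := h.exists_coord hxb hP
    by_contra hne
    have h1 := happ ⟨R, hR⟩ i
    rw [hw.apply, hτ] at h1
    have h2 := congrArg (f j) h1
    rw [map_smul, map_smul, hfx, hfx, if_pos rfl, if_neg (Ne.symm hne), smul_zero, smul_eq_mul,
      mul_one] at h2
    exact (hw.pos i).ne' h2

theorem sum_pos (h : HasSharedRange 𝒮 r Y) {x : Fin r → X} (hx : IsDisjointBasis Y x) :
    0 < ∑ i, x i :=
  Finset.sum_pos (fun i _ => hx.pos i) ⟨⟨0, h.rank_pos⟩, Finset.mem_univ _⟩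

theorem apply_sum {x : Fin r → X} {S : X →L[ℝ] X} {c : ℝ} {σ : Equiv.Perm (Fin r)}
    (hSx : ∀ i, S (x i) = c • x (σ i)) : S (∑ i, x i) = c • ∑ i, x i := by
  rw [map_sum, Finset.smul_sum, ← Equiv.sum_comp σ fun i => c • x i]
  exact Finset.sum_congr rfl fun i _ => hSx i

theorem eigenvector_unique (h : HasSharedRange 𝒮 r Y) {x : Fin r → X}
    (hx : IsPermutedBasis 𝒮 Y x) (hinv : ∀ S : 𝒮, ∀ y ∈ Y, (S : X →L[ℝ] X) y ∈ Y)
    {lam : 𝒮 → ℝ} {y : X}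
    (hy : IsCommonEigenvector (fun S : 𝒮 => (S : X →L[ℝ] X)) lam y) :
    ((0 ≤ y ∨ ∀ S : 𝒮, (S : X →L[ℝ] X) ≠ 0 → 0 < lam S) → ∃ c : ℝ, y = c • ∑ i, x i) ∧
    ((∀ P ∈ rankProjections 𝒮 r, P y = 0) ∨
      ((∀ S : 𝒮, |lam S| = restrictRadius S Y (hinv S)) ∧
        ∃ (c : ℝ) (a : Fin r → ℝ), (∀ i, |a i| = c) ∧ y = ∑ i, a i • x i)) := by
  obtain ⟨hy0, hlam⟩ := hy
  have hxb := hx.isDisjointBasis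
  obtain ⟨σ, hσ, hρ0, hρ, htrans⟩ := h.exists_perm hx hinv
  have key : ∀ P ∈ rankProjections 𝒮 r, P y ≠ 0 → ∃ a : Fin r → ℝ, y = ∑ i, a i • x i ∧
      (0 ≤ y → ∀ i, 0 ≤ a i) ∧ (∀ S : 𝒮, |lam S| = restrictRadius S Y (hinv S)) ∧
      (∃ c, ∀ i, |a i| = c) ∧
      (((∀ i, 0 ≤ a i) ∨ ∀ S : 𝒮, (S : X →L[ℝ] X) ≠ 0 → 0 < lam S) → ∃ c, ∀ i, a i = c) := by
    intro P hP hPy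
    obtain ⟨f, hf0, hfx, hfP⟩ := h.exists_coord hxb hP
    have hPl : P y = lam ⟨P, hP.1⟩ • y := hlam ⟨P, hP.1⟩
    have hlP : lam ⟨P, hP.1⟩ ≠ 0 := fun h0 => hPy (by rw [hPl, h0, zero_smul])
    -- `P y` is a nonzero multiple of `y`, so `y` inherits membership in `Y`.
    have hyY : y ∈ Y := by
      have := Y.smul_mem (lam ⟨P, hP.1⟩)⁻¹ (h.proj_mem hP y)
      rwa [hPl, inv_smul_smul₀ hlP] at this
    have hysum : y = ∑ i, f i y • x i := by rw [← hfP, h.fix hP hyY]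
    refine ⟨fun i => f i y, hysum, fun h0 i => hf0 i y h0, eigenCoefficients hρ0 hρ htrans
      (fun h0 => hy0 ?_) fun S i => ?_⟩
    · rw [hysum]
      exact Finset.sum_eq_zero fun i _ => by rw [show f i y = 0 from congrFun h0 i, zero_smul]
    · have h1 : f (σ S i) ((S : X →L[ℝ] X) y) = lam S * f (σ S i) y := by
        rw [hlam S, map_smul, smul_eq_mul]
      rw [← h1]
      conv_rhs => rw [hysum]
      simp [hσ, hfx, mul_comm]
  have hproj : (0 ≤ y ∨ ∀ S : 𝒮, (S : X →L[ℝ] X) ≠ 0 → 0 < lam S) →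
      ∃ P ∈ rankProjections 𝒮 r, P y ≠ 0 := by
    rintro (h0 | h0)
    · exact h.exists_proj_apply_ne_zero h0 hy0
    · obtain ⟨P, hP⟩ := h.exists_proj
      refine ⟨P, hP, ?_⟩
      have hPl : P y = lam ⟨P, hP.1⟩ • y := hlam ⟨P, hP.1⟩
      rw [hPl]
      exact smul_ne_zero (h0 ⟨P, hP.1⟩ (h.proj_ne_zero hP)).ne' hy0
  refine ⟨fun hor => ?_, ?_⟩
  · obtain ⟨P, hP, hPy⟩ := hproj hor
    obtain ⟨a, hya, ha0, -, -, ha⟩ := key P hP hPy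
    obtain ⟨c, hc⟩ := ha (hor.imp ha0 id)
    exact ⟨c, by rw [hya, Finset.smul_sum]; exact Finset.sum_congr rfl fun i _ => by rw [hc]⟩
  · by_cases hall : ∀ P ∈ rankProjections 𝒮 r, P y = 0
    · exact Or.inl hall
    · push Not at hall
      obtain ⟨P, hP, hPy⟩ := hall
      obtain ⟨a, hya, -, hl, ⟨c, hc⟩, -⟩ := key P hP hPy
      exact Or.inr ⟨hl, c, a, hc, hya⟩

/-- The unique projection of minimal rank commutes with the semigroup. -/
theorem proj_commute (h : HasSharedRange 𝒮 r Y) {P : X →L[ℝ] X} (hP : rankProjections 𝒮 r = {P})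
    {S : X →L[ℝ] X} (hS : S ∈ 𝒮) (z : X) : P (S z) = S (P z) := by
  have hPm : P ∈ rankProjections 𝒮 r := hP ▸ rfl
  by_cases hS0 : S = 0
  · simp [hS0]
  -- By uniqueness the projection with the kernel of `P * S` is `P` itself, so `P * S` annihilates
  -- `z - P z`.
  obtain ⟨Q, hQ, hker⟩ := h.exists_proj_ker_eq hPm hS hS0
  rw [hP, Set.mem_singleton_iff] at hQ
  subst hQ
  have h1 : Q (S (z - Q z)) = 0 := by
    rw [hker, map_sub, h.fix hPm (h.proj_mem hPm z), sub_self]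
  rw [map_sub, map_sub, sub_eq_zero] at h1
  rw [h1, h.fix hPm (h.apply_mem hS (h.proj_mem hPm z))]

theorem dual_statement (h : HasSharedRange 𝒮 r Y) {x : Fin r → X}
    (hx : IsPermutedBasis 𝒮 Y x) (hinv : ∀ S : 𝒮, ∀ y ∈ Y, (S : X →L[ℝ] X) y ∈ Y)
    {P : X →L[ℝ] X} (hP : rankProjections 𝒮 r = {P}) :
    ∃ f : Fin r → StrongDual ℝ X,
      (∀ i, ∀ z : X, 0 ≤ z → 0 ≤ f i z) ∧
      (∀ i j, f i (x j) = if i = j then 1 else 0) ∧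
      (∀ z : X, P z = ∑ i, f i z • x i) ∧
      (∀ S : 𝒮, (S : X →L[ℝ] X) ≠ 0 → ∃ σ : Equiv.Perm (Fin r), ∀ i,
        (restrictRadius S Y (hinv S))⁻¹ • bdual S (f i) = f (σ i)) ∧
      (∀ z : X, 0 < z → 0 < (∑ i, f i) z) ∧
      IsCommonEigenvector (fun S : 𝒮 => bdual (S : X →L[ℝ] X))
        (fun S => restrictRadius S Y (hinv S)) (∑ i, f i) ∧
      (∀ (lam : 𝒮 → ℝ) (g : StrongDual ℝ X),
        IsCommonEigenvector (fun S : 𝒮 => bdual (S : X →L[ℝ] X)) lam g →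
        (((∀ z : X, 0 ≤ z → 0 ≤ g z) ∨ ∀ S : 𝒮, (S : X →L[ℝ] X) ≠ 0 → 0 < lam S) →
          ∃ c : ℝ, g = c • ∑ i, f i) ∧
        (bdual P g = 0 ∨
          ((∀ S : 𝒮, |lam S| = restrictRadius S Y (hinv S)) ∧
            ∃ (c : ℝ) (a : Fin r → ℝ), (∀ i, |a i| = c) ∧ g = ∑ i, a i • f i))) := by
  have hPm : P ∈ rankProjections 𝒮 r := hP ▸ rfl
  have hxb := hx.isDisjointBasis
  obtain ⟨σ, hσ, hρ0, hρ, htrans⟩ := h.exists_perm hx hinv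
  obtain ⟨f, hf0, hfx, hfP⟩ := h.exists_coord hxb hPm
  have hbd : ∀ (S : X →L[ℝ] X) (g : StrongDual ℝ X) z, bdual S g z = g (S z) := fun S g z => rfl
  have hfPz : ∀ i z, f i (P z) = f i z := fun i z => by
    rw [hfP]
    simp [hfx]
  -- Since `f i` factors through `P`, which commutes with `S`, the action of `S` on the basis
  -- determines that of the adjoint on the functionals.
  have hfS : ∀ (S : 𝒮) i, bdual (S : X →L[ℝ] X) (f (σ S i)) =
      restrictRadius (S : X →L[ℝ] X) Y (hinv S) • f i := fun S i => by
    ext z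
    rw [hbd, ← hfPz, h.proj_commute hP S.2, hfP]
    simp [hσ, hfx, mul_comm]
  have hfS' : ∀ (S : 𝒮) i, bdual (S : X →L[ℝ] X) (f i) =
      restrictRadius (S : X →L[ℝ] X) Y (hinv S) • f ((σ S).symm i) := fun S i => by
    rw [← hfS, Equiv.apply_symm_apply]
  let o : Fin r := ⟨0, h.rank_pos⟩
  refine ⟨f, hf0, hfx, hfP, fun S hS => ⟨(σ S).symm, fun i => ?_⟩, fun z hz => ?_,
    ⟨fun h0 => ?_, fun S => ?_⟩, fun lam g hg => ?_⟩
  · rw [hfS', inv_smul_smul₀ (hρ S hS).ne']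
  · obtain ⟨Q, hQ, hQz⟩ := h.exists_proj_apply_ne_zero hz.le hz.ne'
    rw [hP, Set.mem_singleton_iff] at hQ
    subst hQ
    rw [sum_apply]
    have hnn : 0 ≤ ∑ i, f i z := Finset.sum_nonneg fun i _ => hf0 i z hz.le
    refine hnn.lt_of_ne' fun h0 => hQz ?_
    rw [hfP]
    refine Finset.sum_eq_zero fun i hi => ?_
    rw [(Finset.sum_eq_zero_iff_of_nonneg fun i _ => hf0 i z hz.le).1 h0 i hi, zero_smul]
  · have h1 := DFunLike.congr_fun h0 (x o)
    rw [sum_apply] at h1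
    simp [hfx] at h1
  · change bdual (S : X →L[ℝ] X) (∑ i, f i) = _
    rw [map_sum, Finset.smul_sum, ← Equiv.sum_comp (σ S)]
    exact Finset.sum_congr rfl fun i _ => hfS S i
  obtain ⟨hg0, hlam⟩ := hg
  have hgS : ∀ (S : 𝒮) z, g ((S : X →L[ℝ] X) z) = lam S * g z := fun S z =>
    DFunLike.congr_fun (hlam S) z
  have key : bdual P g ≠ 0 → g = ∑ i, g (x i) • f i ∧
      (∀ S : 𝒮, |lam S| = restrictRadius S Y (hinv S)) ∧
      (∃ c, ∀ i, |g (x i)| = c) ∧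
      (((∀ i, 0 ≤ g (x i)) ∨ ∀ S : 𝒮, (S : X →L[ℝ] X) ≠ 0 → 0 < lam S) →
        ∃ c, ∀ i, g (x i) = c) := by
    intro hPg
    have hgP : ∀ z, g (P z) = lam ⟨P, hPm.1⟩ * g z := hgS ⟨P, hPm.1⟩
    obtain ⟨z₀, hz₀⟩ : ∃ z, g (P z) ≠ 0 := by
      by_contra! h0
      exact hPg (ContinuousLinearMap.ext h0)
    -- `P` is idempotent, so its eigenvalue on `g` is 0 or 1, and `P* g ≠ 0` excludes 0. Hence `g =
    -- g ∘ P` is determined by the values `g (x i)`.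
    have hl1 : lam ⟨P, hPm.1⟩ = 1 := by
      have h1 := hgP (P z₀)
      rw [h.fix hPm (h.proj_mem hPm z₀)] at h1
      exact (mul_eq_right₀ hz₀).1 h1.symm
    have hgsum : g = ∑ i, g (x i) • f i := by
      ext z
      rw [← one_mul (g z), ← hl1, ← hgP, hfP, map_sum, sum_apply]
      exact Finset.sum_congr rfl fun i _ => by simp [mul_comm]
    refine ⟨hgsum, eigenCoefficients (σ := fun S => (σ S).symm) hρ0 hρ (fun i j => ?_) (fun h0 => hg0 ?_)
      fun S i => ?_⟩
    · obtain ⟨S, hS, hSi⟩ := htrans j i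
      exact ⟨S, hS, by rw [Equiv.symm_apply_eq, hSi]⟩
    · rw [hgsum]
      exact Finset.sum_eq_zero fun i _ => by rw [show g (x i) = 0 from congrFun h0 i, zero_smul]
    · rw [← hgS, hσ, map_smul, smul_eq_mul, Equiv.apply_symm_apply]
  refine ⟨fun hor => ?_, or_iff_not_imp_left.2 fun hPg => ?_⟩
  · have hPg : bdual P g ≠ 0 := by
      rcases hor with h0 | h0
      -- Irreducibility applied to the positive functional `g` gives `g (R (x o)) = lam R * g (x o)
      -- ≠ 0`, so `g` does not vanish on `Y`.
      · obtain ⟨R, hR, hRx⟩ := exists_apply_ne_zero h.pos h.irreducible h.exists_ne_zero h0 hg0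
          (hx.pos o).le (hx.pos o).ne'
        intro hz
        have h1 : g (x o) = 0 := by
          have := DFunLike.congr_fun hz (x o)
          rwa [hbd, h.fix hPm (hxb.mem o)] at this
        exact hRx (by rw [hgS ⟨R, hR⟩, h1, mul_zero])
      · have := hlam ⟨P, hPm.1⟩
        intro hz
        exact smul_ne_zero (h0 ⟨P, hPm.1⟩ (h.proj_ne_zero hPm)).ne' hg0 (this.symm.trans hz)
    obtain ⟨hgsum, -, -, hc⟩ := key hPg
    obtain ⟨c, hc⟩ := hc (hor.imp (fun h0 i => h0 _ (hx.pos i).le) id)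
    refine ⟨c, hgsum.trans ?_⟩
    rw [Finset.smul_sum]
    exact Finset.sum_congr rfl fun i _ => by rw [hc]
  · obtain ⟨hgsum, hl, ⟨c, hc⟩, -⟩ := key hPg
    exact ⟨hl, c, _, hc, hgsum⟩

end HasSharedRange

end Main

end PosSemigroup

theorem mainTheorem6 {X : Type*} [NormedAddCommGroup X] [NormedSpace ℝ X] [CompleteSpace X]
    [Lattice X] [IsOrderedAddMonoid X] [IsOrderedModule ℝ X] [HasSolidNorm X]
    (𝒮 : Subsemigroup (X →L[ℝ] X))
    (hpos : ∀ S ∈ 𝒮, PosSemigroup.IsPositiveOp S)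
    (hclosed : PosSemigroup.IsRPlusClosed 𝒮)
    (hirr : PosSemigroup.IsIdealIrreducible 𝒮)
    (r : ℕ) (hr : PosSemigroup.minRank 𝒮 = r)
    (Y : Submodule ℝ X)
    (hY : ∀ P ∈ PosSemigroup.rankProjections 𝒮 r, LinearMap.range (P : X →ₗ[ℝ] X) = Y) :
    ∃ hinv : ∀ S : 𝒮, ∀ y ∈ Y, (S : X →L[ℝ] X) y ∈ Y,
      (∀ S : 𝒮, (S : X →L[ℝ] X) ≠ 0 → 0 < PosSemigroup.restrictRadius S Y (hinv S)) ∧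
      (∃ x : Fin r → X, PosSemigroup.IsPermutedBasis 𝒮 Y x) ∧
      ∀ x : Fin r → X, PosSemigroup.IsPermutedBasis 𝒮 Y x →
        -- the common eigenvector `x₀ = x₁ + ⋯ + x_r`
        (0 < ∑ i, x i ∧ PosSemigroup.IsQuasiInterior (∑ i, x i) ∧
          PosSemigroup.IsCommonEigenvector (fun S : 𝒮 => (S : X →L[ℝ] X))
            (fun S => PosSemigroup.restrictRadius S Y (hinv S)) (∑ i, x i)) ∧
        -- its uniqueness up to scaling
        (∀ (lam : 𝒮 → ℝ) (y : X),
          PosSemigroup.IsCommonEigenvector (fun S : 𝒮 => (S : X →L[ℝ] X)) lam y →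
          ((0 ≤ y ∨ ∀ S : 𝒮, (S : X →L[ℝ] X) ≠ 0 → 0 < lam S) →
            ∃ c : ℝ, y = c • ∑ i, x i) ∧
          ((∀ P ∈ PosSemigroup.rankProjections 𝒮 r, P y = 0) ∨
            ((∀ S : 𝒮, |lam S| = PosSemigroup.restrictRadius S Y (hinv S)) ∧
              ∃ (c : ℝ) (a : Fin r → ℝ), (∀ i, |a i| = c) ∧ y = ∑ i, a i • x i))) ∧
        -- the dual statement, when there is only one projection of rank `r`
        (∀ P : X →L[ℝ] X, PosSemigroup.rankProjections 𝒮 r = {P} →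
          ∃ f : Fin r → StrongDual ℝ X,
            (∀ i, ∀ z : X, 0 ≤ z → 0 ≤ f i z) ∧
            (∀ i j, f i (x j) = if i = j then 1 else 0) ∧
            (∀ z : X, P z = ∑ i, f i z • x i) ∧
            (∀ S : 𝒮, (S : X →L[ℝ] X) ≠ 0 → ∃ σ : Equiv.Perm (Fin r), ∀ i,
              (PosSemigroup.restrictRadius S Y (hinv S))⁻¹ • PosSemigroup.bdual S (f i)
                = f (σ i)) ∧
            (∀ z : X, 0 < z → 0 < (∑ i, f i) z) ∧
            PosSemigroup.IsCommonEigenvector (fun S : 𝒮 => PosSemigroup.bdual (S : X →L[ℝ] X))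
              (fun S => PosSemigroup.restrictRadius S Y (hinv S)) (∑ i, f i) ∧
            (∀ (lam : 𝒮 → ℝ) (g : StrongDual ℝ X),
              PosSemigroup.IsCommonEigenvector
                (fun S : 𝒮 => PosSemigroup.bdual (S : X →L[ℝ] X)) lam g →
              (((∀ z : X, 0 ≤ z → 0 ≤ g z) ∨ ∀ S : 𝒮, (S : X →L[ℝ] X) ≠ 0 → 0 < lam S) →
                ∃ c : ℝ, g = c • ∑ i, f i) ∧
              (PosSemigroup.bdual P g = 0 ∨
                ((∀ S : 𝒮, |lam S| = PosSemigroup.restrictRadius S Y (hinv S)) ∧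
                  ∃ (c : ℝ) (a : Fin r → ℝ), (∀ i, |a i| = c) ∧ g = ∑ i, a i • f i)))) := by
  have h : PosSemigroup.HasSharedRange 𝒮 r Y := ⟨hpos, hclosed, hirr, hr, hY⟩
  obtain ⟨x₀, hx₀⟩ := h.exists_isPermutedBasis
  refine ⟨fun S y hy => h.apply_mem S.2 hy, ?_, ⟨x₀, hx₀⟩, fun x hx => ?_⟩
  · obtain ⟨-, -, -, hρ, -⟩ := h.exists_perm hx₀ fun S y hy => h.apply_mem S.2 hy
    exact hρ
  obtain ⟨σ, hσ, -⟩ := h.exists_perm hx fun S y hy => h.apply_mem S.2 hy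
  have hsum := h.sum_pos hx.isDisjointBasis
  have heig := fun S : 𝒮 => PosSemigroup.HasSharedRange.apply_sum (hσ S)
  exact ⟨⟨hsum, PosSemigroup.isQuasiInterior_of_apply_le hpos hirr hsum
      fun S hS => ⟨_, heig ⟨S, hS⟩⟩, hsum.ne', heig⟩,
    fun lam y hy => h.eigenvector_unique hx _ hy, fun P hP => h.dual_statement hx _ hP⟩
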